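/- Let $n\geq 1$ be an integer and let $q\in\mathbb{C}^{\times}$ be not a root of unity. Let $\mathcal{O}_q(M_n)$ be the unital associative $\mathbb{C}$-algebra with generators $x_{i,j}$ ($1\le i,j\le n$) and relations \[ x_{i,j}x_{k,l}=\begin{cases} x_{k,l}x_{i,j}+(q-q^{-1})\,x_{i,l}x_{k,j} & \text{if } i<k \text{ and } j<l,\\ q\,x_{k,l}x_{i,j} & \text{if } (i=k \text{ and } j<l) \text{ or } (j=l \text{ and } i<k),\\ x_{k,l}x_{i,j} & \text{if } i<k \text{ and } j>l. \end{cases} \] For subsets $I=\{i_1<\dots<i_t\}$ and $J=\{j_1<\dots<j_t\}$ of $\{1,\dots,n\}$ let \[ [I\,|\,J]=\sum_{s\in S_t}(-q)^{\ell(s)}x_{i_1,j_{s(1)}}x_{i_2,j_{s(2)}}\cdots x_{i_t,j_{s(t)}}, \] where $\ell(s)$ is the number of inversions of $s$. Let $\sigma_t=\sum_{|I|=t}[I\,|\,I]$ for $1\le t\le n$, so that $\sigma_1=x_{1,1}+\dots+x_{n,n}$ and $\sigma_n=\det_q:=[\{1,\dots,n\}\,|\,\{1,\dots,n\}]$. Let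 $\mathcal{O}_q(GL_n)=\mathcal{O}_q(M_n)[\det_q^{-1}]$ be the localization at $\det_q$, with the images of the $\sigma_t$ again denoted by $\sigma_t$, and let $\mathcal{O}_q(SL_n)=\mathcal{O}_q(M_n)/(\det_q-1)$, with $\overline{\sigma}_t$ the image of $\sigma_t$. Write $\mathbb{C}\langle\dots\rangle$ for the generated unital $\mathbb{C}$-subalgebra. Then the following are equivalent: \begin{enumerate} \item The centralizer of $\sigma_1$ in $\mathcal{O}_q(M_n)$ is $\mathbb{C}\langle\sigma_1,\dots,\sigma_n\rangle$. \item The centralizer of $\sigma_1$ in $\mathcal{O}_q(GL_n)$ is $\mathbb{C}\langle\sigma_1,\dots,\sigma_n,\sigma_n^{-1}\rangle$. \item The centralizer of $\overline{\sigma}_1$ in $\mathcal{O}_q(SL_n)$ is $\mathbb{C}\langle\overline{\sigma}_1,\dots,\overline{\sigma}_{n-1}\rangle$. \end{enumerate} -/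

import Mathlib

noncomputable section

namespace QuantumMatrices

/-- The Coxeter length of a permutation: its number of inversions. -/
def permLength {t : ℕ} (s : Equiv.Perm (Fin t)) : ℕ :=
  (Finset.univ.filter fun p : Fin t × Fin t => p.1 < p.2 ∧ s p.2 < s p.1).card

/-- The expression `∑ₛ (-q)^ℓ(s) X₁,ₛ₍₁₎ X₂,ₛ₍₂₎ ⋯ Xₜ,ₛ₍ₜ₎`, with the products taken in this order,
for a square array `X` of elements of a `ℂ`-algebra. -/
def qDet {A : Type*} [Ring A] [Algebra ℂ A] (q : ℂ) {t : ℕ} (X : Matrix (Fin t) (Fin t) A) : A :=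
  ∑ s : Equiv.Perm (Fin t), (-q) ^ permLength s • (List.ofFn fun a => X a (s a)).prod

/-- The quantum minor `[I | J]`; rows and columns are listed in increasing order. -/
def qMinor {A : Type*} [Ring A] [Algebra ℂ A] (q : ℂ) {n t : ℕ} (X : Matrix (Fin n) (Fin n) A)
    (I J : Finset (Fin n)) (hI : I.card = t) (hJ : J.card = t) : A :=
  qDet q (X.submatrix (I.orderEmbOfFin hI) (J.orderEmbOfFin hJ))

/-- The sum of the principal quantum minors of size `t`. -/
def qSigma {A : Type*} [Ring A] [Algebra ℂ A] (q : ℂ) {n : ℕ} (X : Matrix (Fin n) (Fin n) A)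
    (t : ℕ) : A :=
  ∑ I : {I : Finset (Fin n) // I.card = t}, qMinor q X I.1 I.1 I.2 I.2

/-- The free generators, as a matrix. -/
def freeX (n : ℕ) : Matrix (Fin n) (Fin n) (FreeAlgebra ℂ (Fin n × Fin n)) :=
  fun i j => FreeAlgebra.ι ℂ (i, j)

/-- The defining relations of the quantized coordinate ring of `n × n` matrices. -/
inductive MRel (n : ℕ) (q : ℂ) :
    FreeAlgebra ℂ (Fin n × Fin n) → FreeAlgebra ℂ (Fin n × Fin n) → Prop
  | diag (i j k l : Fin n) (hik : i < k) (hjl : j < l) :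
      MRel n q (freeX n i j * freeX n k l)
        (freeX n k l * freeX n i j + (q - q⁻¹) • (freeX n i l * freeX n k j))
  | row (i j l : Fin n) (hjl : j < l) :
      MRel n q (freeX n i j * freeX n i l) (q • (freeX n i l * freeX n i j))
  | col (i j k : Fin n) (hik : i < k) :
      MRel n q (freeX n i j * freeX n k j) (q • (freeX n k j * freeX n i j))
  | anti (i j k l : Fin n) (hik : i < k) (hlj : l < j) :
      MRel n q (freeX n i j * freeX n k l) (freeX n k l * freeX n i j)

/-- The quantized coordinate ring of `n × n` matrices. -/
def OqM (n : ℕ) (q : ℂ) : Type := RingQuot (MRel n q)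

instance (n : ℕ) (q : ℂ) : Ring (OqM n q) := inferInstanceAs (Ring (RingQuot (MRel n q)))

instance (n : ℕ) (q : ℂ) : Algebra ℂ (OqM n q) :=
  inferInstanceAs (Algebra ℂ (RingQuot (MRel n q)))

/-- The projection from the free algebra. -/
def mkM (n : ℕ) (q : ℂ) : FreeAlgebra ℂ (Fin n × Fin n) →ₐ[ℂ] OqM n q :=
  RingQuot.mkAlgHom ℂ (MRel n q)

theorem mkM_rel (n : ℕ) (q : ℂ) ⦃a b : FreeAlgebra ℂ (Fin n × Fin n)⦄
    (h : MRel n q a b) : mkM n q a = mkM n q b :=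
  RingQuot.mkAlgHom_rel ℂ h

/-- Homomorphisms out of `OqM n q` from homomorphisms that respect the relations. -/
def liftM {n : ℕ} {q : ℂ} {B : Type*} [Ring B] [Algebra ℂ B]
    (F : FreeAlgebra ℂ (Fin n × Fin n) →ₐ[ℂ] B)
    (hF : ∀ ⦃a b⦄, MRel n q a b → F a = F b) : OqM n q →ₐ[ℂ] B :=
  RingQuot.liftAlgHom ℂ ⟨F, hF⟩

theorem liftM_mk {n : ℕ} {q : ℂ} {B : Type*} [Ring B] [Algebra ℂ B]
    (F : FreeAlgebra ℂ (Fin n × Fin n) →ₐ[ℂ] B)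
    (hF : ∀ ⦃a b⦄, MRel n q a b → F a = F b) (a : FreeAlgebra ℂ (Fin n × Fin n)) :
    liftM F hF (mkM n q a) = F a :=
  RingQuot.liftAlgHom_mkAlgHom_apply ℂ F hF a

theorem mkM_surjective (n : ℕ) (q : ℂ) : Function.Surjective (mkM n q) :=
  RingQuot.mkAlgHom_surjective ℂ (MRel n q)

/-- The matrix of generators `x i j` of `OqM n q`. -/
def genX (n : ℕ) (q : ℂ) : Matrix (Fin n) (Fin n) (OqM n q) :=
  fun i j => mkM n q (freeX n i j)

/-- The quantum determinant in `OqM n q`. -/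
def detM (n : ℕ) (q : ℂ) : OqM n q := qDet q (genX n q)

/-- The element `σ_t` of `OqM n q`. -/
def sigmaM (n : ℕ) (q : ℂ) (t : ℕ) : OqM n q := qSigma q (genX n q) t

/-- The quantized coordinate ring of `SL_n`: the quotient by the two-sided ideal `(det_q - 1)`. -/
abbrev OqSL (n : ℕ) (q : ℂ) : Type :=
  (TwoSidedIdeal.span {detM n q - 1}).ringCon.Quotient

/-- The quotient map onto `OqSL n q`. -/
def toSL (n : ℕ) (q : ℂ) : OqM n q →ₐ[ℂ] OqSL n q :=
  (TwoSidedIdeal.span {detM n q - 1}).ringCon.mkₐ (α := ℂ)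

/-- The embedding of free algebras that adds the free generator `none`. -/
def freeIncl (n : ℕ) :
    FreeAlgebra ℂ (Fin n × Fin n) →ₐ[ℂ] FreeAlgebra ℂ (Option (Fin n × Fin n)) :=
  FreeAlgebra.lift ℂ fun p => FreeAlgebra.ι ℂ (some p)

/-- The relations of `OqM n q`, together with those saying that the extra generator is a two-sided
inverse of the quantum determinant. -/
inductive GLRel (n : ℕ) (q : ℂ) : FreeAlgebra ℂ (Option (Fin n × Fin n)) →
    FreeAlgebra ℂ (Option (Fin n × Fin n)) → Prop
  | ofM (a b : FreeAlgebra ℂ (Fin n × Fin n)) (h : MRel n q a b) :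
      GLRel n q (freeIncl n a) (freeIncl n b)
  | det_mul_inv : GLRel n q (freeIncl n (qDet q (freeX n)) * FreeAlgebra.ι ℂ none) 1
  | inv_mul_det : GLRel n q (FreeAlgebra.ι ℂ none * freeIncl n (qDet q (freeX n))) 1

/-- The quantized coordinate ring of `GL_n`: the localization of `OqM n q` at the quantum
determinant, obtained by freely adjoining a two-sided inverse (see `existsUnique_lift_GL`). -/
def OqGL (n : ℕ) (q : ℂ) : Type := RingQuot (GLRel n q)

instance (n : ℕ) (q : ℂ) : Ring (OqGL n q) := inferInstanceAs (Ring (RingQuot (GLRel n q)))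

instance (n : ℕ) (q : ℂ) : Algebra ℂ (OqGL n q) :=
  inferInstanceAs (Algebra ℂ (RingQuot (GLRel n q)))

/-- The projection from the free algebra. -/
def mkGL (n : ℕ) (q : ℂ) : FreeAlgebra ℂ (Option (Fin n × Fin n)) →ₐ[ℂ] OqGL n q :=
  RingQuot.mkAlgHom ℂ (GLRel n q)

theorem mkGL_rel (n : ℕ) (q : ℂ) ⦃a b : FreeAlgebra ℂ (Option (Fin n × Fin n))⦄
    (h : GLRel n q a b) : mkGL n q a = mkGL n q b :=
  RingQuot.mkAlgHom_rel ℂ h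

/-- Homomorphisms out of `OqGL n q` from homomorphisms that respect the relations. -/
def liftGL {n : ℕ} {q : ℂ} {B : Type*} [Ring B] [Algebra ℂ B]
    (F : FreeAlgebra ℂ (Option (Fin n × Fin n)) →ₐ[ℂ] B)
    (hF : ∀ ⦃a b⦄, GLRel n q a b → F a = F b) : OqGL n q →ₐ[ℂ] B :=
  RingQuot.liftAlgHom ℂ ⟨F, hF⟩

theorem liftGL_mk {n : ℕ} {q : ℂ} {B : Type*} [Ring B] [Algebra ℂ B]
    (F : FreeAlgebra ℂ (Option (Fin n × Fin n)) →ₐ[ℂ] B)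
    (hF : ∀ ⦃a b⦄, GLRel n q a b → F a = F b) (a : FreeAlgebra ℂ (Option (Fin n × Fin n))) :
    liftGL F hF (mkGL n q a) = F a :=
  RingQuot.liftAlgHom_mkAlgHom_apply ℂ F hF a

theorem mkGL_surjective (n : ℕ) (q : ℂ) : Function.Surjective (mkGL n q) :=
  RingQuot.mkAlgHom_surjective ℂ (GLRel n q)

/-- The canonical map from `OqM n q` to its localization. -/
def toGL (n : ℕ) (q : ℂ) : OqM n q →ₐ[ℂ] OqGL n q :=
  liftM ((mkGL n q).comp (freeIncl n)) fun _ _ h => mkGL_rel n q (GLRel.ofM _ _ h)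

theorem toGL_mkM (n : ℕ) (q : ℂ) (a : FreeAlgebra ℂ (Fin n × Fin n)) :
    toGL n q (mkM n q a) = mkGL n q (freeIncl n a) :=
  liftM_mk _ _ a

/-- The element `det_q⁻¹ = σ_n⁻¹` of `OqGL n q`. -/
def detInv (n : ℕ) (q : ℂ) : OqGL n q :=
  mkGL n q (FreeAlgebra.ι ℂ none)

theorem map_qDet {A B : Type*} [Ring A] [Algebra ℂ A] [Ring B] [Algebra ℂ B] (f : A →ₐ[ℂ] B)
    (q : ℂ) {t : ℕ} (X : Matrix (Fin t) (Fin t) A) :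
    f (qDet q X) = qDet q (fun i j => f (X i j)) := by
  simp [qDet, map_list_prod, List.map_ofFn, Function.comp_def]

theorem mk_qDet_freeX (n : ℕ) (q : ℂ) :
    mkM n q (qDet q (freeX n)) = detM n q :=
  map_qDet _ q _

theorem toGL_detM (n : ℕ) (q : ℂ) :
    toGL n q (detM n q) =
      mkGL n q (freeIncl n (qDet q (freeX n))) := by
  rw [← mk_qDet_freeX, toGL_mkM]

theorem toGL_detM_mul_detInv (n : ℕ) (q : ℂ) : toGL n q (detM n q) * detInv n q = 1 := by
  rw [toGL_detM, detInv, ← map_mul, mkGL_rel n q GLRel.det_mul_inv, map_one]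

theorem detInv_mul_toGL_detM (n : ℕ) (q : ℂ) : detInv n q * toGL n q (detM n q) = 1 := by
  rw [toGL_detM, detInv, ← map_mul, mkGL_rel n q GLRel.inv_mul_det, map_one]

theorem sigmaM_self (n : ℕ) (q : ℂ) : sigmaM n q n = detM n q := by
  have hu : ∀ I : {I : Finset (Fin n) // I.card = n}, I = ⟨Finset.univ, by simp⟩ := by
    rintro ⟨I, hI⟩
    exact Subtype.ext (Finset.eq_univ_of_card I (by simpa using hI))
  let _ : Unique {I : Finset (Fin n) // I.card = n} := ⟨⟨⟨Finset.univ, by simp⟩⟩, hu⟩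
  have he : ∀ h : (Finset.univ : Finset (Fin n)).card = n,
      ⇑((Finset.univ : Finset (Fin n)).orderEmbOfFin h) = id := by
    intro h
    exact (Finset.orderEmbOfFin_unique h (by simp) strictMono_id).symm
  rw [sigmaM, qSigma, Fintype.sum_unique, hu default]
  simp only [qMinor, he]
  rfl

/-- The universal property of the localization. -/
theorem existsUnique_lift_GL (n : ℕ) (q : ℂ) {B : Type*} [Ring B] [Algebra ℂ B]
    (f : OqM n q →ₐ[ℂ] B) (hf : IsUnit (f (detM n q))) :
    ∃! g : OqGL n q →ₐ[ℂ] B, g.comp (toGL n q) = f := by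
  obtain ⟨u, hu⟩ := hf
  let F : FreeAlgebra ℂ (Option (Fin n × Fin n)) →ₐ[ℂ] B :=
    FreeAlgebra.lift ℂ fun o => o.elim (↑u⁻¹ : B) fun p => f (genX n q p.1 p.2)
  have hF : F.comp (freeIncl n) = f.comp (mkM n q) := by
    ext p
    simp [F, freeIncl, genX, freeX]
  have hF' : ∀ a, F (freeIncl n a) = f (mkM n q a) :=
    fun a => DFunLike.congr_fun hF a
  have hN : F (FreeAlgebra.ι ℂ none) = ↑u⁻¹ := by simp [F]
  have hR : ∀ ⦃a b⦄, GLRel n q a b → F a = F b := by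
    rintro _ _ (⟨a, b, h⟩ | _ | _)
    · rw [hF', hF', mkM_rel n q h]
    · rw [map_mul, hF', hN, mk_qDet_freeX, ← hu, map_one, Units.mul_inv]
    · rw [map_mul, hF', hN, mk_qDet_freeX, ← hu, map_one, Units.inv_mul]
  refine ⟨liftGL F hR, ?_, ?_⟩
  · ext y
    obtain ⟨a, rfl⟩ := mkM_surjective n q y
    rw [AlgHom.comp_apply, toGL_mkM, liftGL_mk, hF']
  · intro g hg
    have hg' : g.comp (mkGL n q) = F := by
      ext o
      simp only [AlgHom.comp_apply, Function.comp_apply]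
      cases o with
      | none =>
        rw [hN]
        have h1 : g (detInv n q) * ↑u = 1 := by
          rw [hu, ← hg, AlgHom.comp_apply, ← map_mul, detInv_mul_toGL_detM, map_one]
        exact (Units.mul_eq_one_iff_eq_inv).1 h1
      | some p =>
        have h2 : freeIncl n (FreeAlgebra.ι ℂ p) = FreeAlgebra.ι ℂ (some p) := by simp [freeIncl]
        rw [← h2, hF', ← hg, AlgHom.comp_apply, toGL_mkM]
    ext y
    obtain ⟨a, rfl⟩ := mkGL_surjective n q y
    rw [liftGL_mk, ← hg', AlgHom.comp_apply]

end QuantumMatrices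

end

/-! All three statements are compared through restriction to the diagonal torus, the homomorphism
`diagHom` that sends x_{ij} to 0 for i ≠ j and x_{ii} to a variable t_i. It sends σ_t to the t-th
elementary symmetric polynomial (`diagHom_sigmaM`), and it is injective on the centralizer of σ₁
(`eq_zero_of_diagHom_eq_zero`). For the injectivity, O_q(M_n) is viewed as an Ore extension by
x_{11}. The leading coefficient of an element that commutes with σ₁ is fixed by the twist τ; since q
is not a root of unity, it comes from the quantum matrices of size n - 1, where it again commutes
with σ₁, and induction applies. Together with the fundamental theorem on symmetric polynomials this
turns statement (1) into a criterion (`centralizer_eq_sigmaAlg_iff`): the σ_i commute with σ₁, and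
every element of the centralizer has a symmetric restriction.

For GL_n, det_q is central by the quantum Cramer rule (`commute_detM`), and O_q(M_n) is a domain,
being an iterated Ore extension (`OqM.noZeroDivisors`). So O_q(M_n) embeds in the localization,
denominators can be cleared, and symmetry of a restriction survives cancelling the symmetric factor
t_1⋯t_n.

For SL_n, the relation det_q = 1 breaks the grading, but the degrees that occur in a nonzero
multiple of det_q - 1 spread over at least n. Hence the quotient map is injective on elements with
degrees in an interval of length n (`eq_of_toSL_eq`), and every class has a representative in such
an interval (`exists_lift_in_window`), because powers of det_q shift degrees by multiples of n. As
σ₁ is homogeneous, commutators with it stay in such an interval, and commutation can be tested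
upstairs. -/

noncomputable section

namespace QuantumMatrices

/-! ### Permutations with one prescribed value, and their inversions -/

/-- The permutation of `Fin (t + 1)` that sends `p` to `j` and is order-isomorphic to `s` on the
complements. -/
def permInsert {t : ℕ} (p j : Fin (t + 1)) (s : Equiv.Perm (Fin t)) : Equiv.Perm (Fin (t + 1)) :=
  (finSuccEquiv' p).trans ((Equiv.optionCongr s).trans (finSuccEquiv' j).symm)

@[simp]
theorem permInsert_self {t : ℕ} (p j : Fin (t + 1)) (s : Equiv.Perm (Fin t)) :
    permInsert p j s p = j := by
  simp [permInsert]

@[simp]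
theorem permInsert_succAbove {t : ℕ} (p j : Fin (t + 1)) (s : Equiv.Perm (Fin t)) (a : Fin t) :
    permInsert p j s (p.succAbove a) = j.succAbove (s a) := by
  simp [permInsert]

@[simp]
theorem permInsert_zero_succ {t : ℕ} (j : Fin (t + 1)) (s : Equiv.Perm (Fin t)) (a : Fin t) :
    permInsert 0 j s a.succ = j.succAbove (s a) := by
  simpa using permInsert_succAbove 0 j s a

@[simp]
theorem permInsert_last_castSucc {t : ℕ} (j : Fin (t + 1)) (s : Equiv.Perm (Fin t)) (a : Fin t) :
    permInsert (Fin.last t) j s a.castSucc = j.succAbove (s a) := by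
  simpa using permInsert_succAbove (Fin.last t) j s a

/-- The value at `p` recovers `j` and the other values recover `s`; counting does the rest. Sums
over the larger symmetric group thereby split into the double sums of the Laplace expansions. -/
theorem permInsert_bijective {t : ℕ} (p : Fin (t + 1)) :
    Function.Bijective fun x : Fin (t + 1) × Equiv.Perm (Fin t) => permInsert p x.1 x.2 := by
  rw [Fintype.bijective_iff_injective_and_card]
  constructor
  · rintro ⟨j, s⟩ ⟨j', s'⟩ h
    have hj : j = j' := by simpa using DFunLike.congr_fun h p
    subst hj
    refine Prod.ext rfl (Equiv.ext fun a => ?_)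
    simpa using DFunLike.congr_fun h (p.succAbove a)
  · simp [Fintype.card_perm, Nat.factorial_succ]

theorem permLength_eq_sum {t : ℕ} (s : Equiv.Perm (Fin t)) :
    permLength s = ∑ a, ∑ b, if a < b ∧ s b < s a then 1 else 0 := by
  rw [permLength, Finset.card_filter, Fintype.sum_prod_type]

theorem permLength_inv {t : ℕ} (s : Equiv.Perm (Fin t)) : permLength s⁻¹ = permLength s := by
  rw [permLength_eq_sum, permLength_eq_sum, Finset.sum_comm]
  rw [← Equiv.sum_comp s]
  refine Finset.sum_congr rfl fun a _ => ?_
  rw [← Equiv.sum_comp s]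
  simp [and_comm]

theorem sum_succAbove_lt {t : ℕ} (j : Fin (t + 1)) :
    (∑ c : Fin t, if j.succAbove c < j then 1 else 0) = (j : ℕ) := by
  have h := Finset.card_filter (fun c : Fin (t + 1) => c < j) Finset.univ
  rw [Fin.sum_univ_succAbove _ j] at h
  simp only [lt_irrefl, if_false, zero_add] at h
  rw [← h, Finset.filter_gt_eq_Iio, Fin.card_Iio]

theorem sum_lt_succAbove {t : ℕ} (j : Fin (t + 1)) :
    (∑ c : Fin t, if j < j.succAbove c then 1 else 0) = t - (j : ℕ) := by
  have h := Finset.card_filter (fun c : Fin (t + 1) => j < c) Finset.univ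
  rw [Fin.sum_univ_succAbove _ j] at h
  simp only [lt_irrefl, if_false, zero_add] at h
  rw [← h, Finset.filter_lt_eq_Ioi, Fin.card_Ioi]
  omega

/-- Position 0 forms an inversion with exactly those positions whose value is below `j`; the other
inversions are those of `s`. -/
theorem permLength_permInsert_zero {t : ℕ} (j : Fin (t + 1)) (s : Equiv.Perm (Fin t)) :
    permLength (permInsert 0 j s) = j + permLength s := by
  rw [permLength_eq_sum, Fin.sum_univ_succ]
  simp only [Fin.sum_univ_succ (n := t), permInsert_self, permInsert_zero_succ, lt_irrefl,
    Fin.succ_pos, Fin.not_lt_zero, false_and, true_and, if_false, zero_add, Fin.succ_lt_succ_iff,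
    Fin.succAbove_lt_succAbove_iff]
  rw [Equiv.sum_comp s (fun c => if j.succAbove c < j then 1 else 0), sum_succAbove_lt,
    ← permLength_eq_sum]

theorem permLength_permInsert_last {t : ℕ} (j : Fin (t + 1)) (s : Equiv.Perm (Fin t)) :
    permLength (permInsert (Fin.last t) j s) = (t - j) + permLength s := by
  rw [permLength_eq_sum, Fin.sum_univ_castSucc]
  simp only [Fin.sum_univ_castSucc (n := t), permInsert_self, permInsert_last_castSucc, lt_irrefl,
    Fin.castSucc_lt_last, not_lt_of_gt (Fin.castSucc_lt_last _), false_and, true_and, if_false,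
    add_zero, Fin.castSucc_lt_castSucc_iff, Fin.succAbove_lt_succAbove_iff, Finset.sum_const_zero,
    Finset.sum_add_distrib]
  rw [Equiv.sum_comp s (fun c => if j < j.succAbove c then 1 else 0), sum_lt_succAbove,
    ← permLength_eq_sum, add_comm]

/-! ### Laplace expansions along the first and the last row -/

section Laplace

variable {A : Type*} [Ring A] [Algebra ℂ A] (q : ℂ)

theorem qDet_succ_row_zero {t : ℕ} (X : Matrix (Fin (t + 1)) (Fin (t + 1)) A) :
    qDet q X = ∑ j : Fin (t + 1),
      (-q) ^ (j : ℕ) • (X 0 j * qDet q (X.submatrix Fin.succ j.succAbove)) := by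
  rw [qDet, ← (permInsert_bijective (0 : Fin (t + 1))).sum_comp, Fintype.sum_prod_type]
  refine Finset.sum_congr rfl fun j _ => ?_
  rw [qDet, Finset.mul_sum, Finset.smul_sum]
  refine Finset.sum_congr rfl fun s _ => ?_
  simp [permLength_permInsert_zero, List.ofFn_succ, pow_add, mul_smul]

theorem qDet_succ_row_last {t : ℕ} (X : Matrix (Fin (t + 1)) (Fin (t + 1)) A) :
    qDet q X = ∑ j : Fin (t + 1), (-q) ^ (t - (j : ℕ)) •
      (qDet q (X.submatrix Fin.castSucc j.succAbove) * X (Fin.last t) j) := by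
  rw [qDet, ← (permInsert_bijective (Fin.last t)).sum_comp, Fintype.sum_prod_type]
  refine Finset.sum_congr rfl fun j _ => ?_
  rw [qDet, Finset.sum_mul, Finset.smul_sum]
  refine Finset.sum_congr rfl fun s _ => ?_
  rw [List.ofFn_succ']
  simp [permLength_permInsert_last, pow_add, mul_smul]

end Laplace

/-! ### Quantum matrices and invariance of the determinant under transposition -/

/-- The relations between the entries of a quantum matrix. -/
structure IsQMatrix (q : ℂ) {A : Type*} [Ring A] [Algebra ℂ A] {m n : ℕ}
    (X : Matrix (Fin m) (Fin n) A) : Prop where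
  diag : ∀ ⦃i j k l⦄, i < k → j < l →
    X i j * X k l = X k l * X i j + (q - q⁻¹) • (X i l * X k j)
  row : ∀ ⦃i j l⦄, j < l → X i j * X i l = q • (X i l * X i j)
  col : ∀ ⦃i j k⦄, i < k → X i j * X k j = q • (X k j * X i j)
  anti : ∀ ⦃i j k l⦄, i < k → l < j → X i j * X k l = X k l * X i j

theorem isQMatrix_genX (n : ℕ) (q : ℂ) : IsQMatrix q (genX n q) where
  diag i j k l h h' := by simpa [genX] using mkM_rel n q (MRel.diag i j k l h h')
  row i j l h := by simpa [genX] using mkM_rel n q (MRel.row i j l h)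
  col i j k h := by simpa [genX] using mkM_rel n q (MRel.col i j k h)
  anti i j k l h h' := by simpa [genX] using mkM_rel n q (MRel.anti i j k l h h')

namespace IsQMatrix

variable {A : Type*} [Ring A] [Algebra ℂ A] {q : ℂ} {m n : ℕ} {X : Matrix (Fin m) (Fin n) A}

/-- The diagonal relation is self-transposed because x_{il} and x_{kj} commute. -/
theorem transpose (h : IsQMatrix q X) : IsQMatrix q X.transpose where
  diag _ _ _ _ hik hjl := by
    simp only [Matrix.transpose_apply]
    rw [h.diag hjl hik, h.anti hjl hik]
  row _ _ _ hjl := h.col hjl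
  col _ _ _ hik := h.row hik
  anti _ _ _ _ hik hlj := (h.anti hlj hik).symm

theorem submatrix (h : IsQMatrix q X) {m' n' : ℕ} {f : Fin m' → Fin m} {g : Fin n' → Fin n}
    (hf : StrictMono f) (hg : StrictMono g) : IsQMatrix q (X.submatrix f g) where
  diag _ _ _ _ hik hjl := h.diag (hf hik) (hg hjl)
  row _ _ _ hjl := h.row (hg hjl)
  col _ _ _ hik := h.col (hf hik)
  anti _ _ _ _ hik hlj := h.anti (hf hik) (hg hlj)

end IsQMatrix

/-- Insertion only moves an element past neighbours that are out of order, and these are assumed to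
commute with it. -/
theorem prod_map_insertionSort {ι A : Type*} [Monoid A] (f : ι → A) (r : ι → ι → Prop)
    [DecidableRel r] (l : List ι)
    (h : l.Pairwise fun a b => ¬ r a b → Commute (f a) (f b)) :
    ((l.insertionSort r).map f).prod = (l.map f).prod := by
  have key : ∀ (a : ι) (l : List ι), (∀ b ∈ l, ¬ r a b → Commute (f a) (f b)) →
      ((l.orderedInsert r a).map f).prod = f a * (l.map f).prod := by
    intro a l
    induction l with
    | nil => simp
    | cons b l ih =>
      intro hb
      by_cases hab : r a b
      · simp [List.orderedInsert, hab]
      · have := hb b (by simp) hab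
        simp only [List.orderedInsert, hab, if_false, List.map_cons, List.prod_cons]
        rw [ih fun c hc => hb c (by simp [hc]), ← mul_assoc, ← mul_assoc, this.eq]
  induction l with
  | nil => simp
  | cons a l ih =>
    rw [List.pairwise_cons] at h
    rw [List.insertionSort_cons, key, ih h.2, List.map_cons, List.prod_cons]
    intro b hb
    exact h.1 b (by simpa using hb)

/-- Two factors of a monomial that form an inversion commute by `anti`. Each monomial can therefore
be sorted by columns instead of rows, and `s ↦ s⁻¹` preserves the length. -/
theorem IsQMatrix.qDet_transpose {A : Type*} [Ring A] [Algebra ℂ A] {q : ℂ} {n : ℕ}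
    {X : Matrix (Fin n) (Fin n) A} (h : IsQMatrix q X) : qDet q X.transpose = qDet q X := by
  rw [qDet, qDet, ← Equiv.sum_comp (Equiv.inv (Equiv.Perm (Fin n)))]
  refine Finset.sum_congr rfl fun s _ => ?_
  rw [Equiv.inv_apply, permLength_inv]
  congr 1
  have h1 : (List.ofFn fun a => X.transpose a (s⁻¹ a)) =
      (((List.finRange n).map s.symm).map fun b => X b (s b)) := by
    simp [List.ofFn_eq_map, Function.comp_def]
  have h2 : (List.ofFn fun a => X a (s a)) = (List.finRange n).map fun b => X b (s b) := by
    simp [List.ofFn_eq_map]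
  rw [h1, h2, ← prod_map_insertionSort (fun b => X b (s b)) (fun a b => s a ≤ s b)
    (List.finRange n)]
  · congr 2
    have : Std.Antisymm fun a b => s a ≤ s b := ⟨fun a b h h' => s.injective (le_antisymm h h')⟩
    have : Std.Total fun a b => s a ≤ s b := ⟨fun a b => le_total _ _⟩
    have : IsTrans _ fun a b => s a ≤ s b := ⟨fun a b c h h' => le_trans h h'⟩
    refine List.Perm.eq_of_pairwise' (r := fun a b => s a ≤ s b) ?_
      (List.pairwise_insertionSort _ _) ?_
    · rw [List.pairwise_map]
      simpa using (List.pairwise_lt_finRange n).imp le_of_lt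
    · refine List.Perm.trans ?_ (List.perm_insertionSort _ _).symm
      rw [List.perm_ext_iff_of_nodup ((List.nodup_finRange n).map s.symm.injective)
        (List.nodup_finRange n)]
      simpa using fun a => s.symm.surjective a
  · refine (List.pairwise_lt_finRange n).imp fun {a b} hab hs => ?_
    exact h.anti hab (not_le.1 hs)

/-! ### Rows as operators on the quantum exterior algebra -/

section Wedge

variable {A : Type*} [Ring A] [Algebra ℂ A]

/-- Left multiplication by `∑ⱼ vⱼ ξⱼ` on the quantum exterior algebra over `A`, whose generators
satisfy `ξⱼ ξᵢ = -q ξᵢ ξⱼ` for `i < j`; elements are given by their coefficients. -/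
def wedge (q : ℂ) {n : ℕ} (v : Fin n → A) : Module.End ℂ (Finset (Fin n) → A) where
  toFun m S := ∑ j ∈ S, (-q) ^ (S.filter (· < j)).card • (v j * m (S.erase j))
  map_add' m m' := by
    ext S
    simp [mul_add, Finset.sum_add_distrib]
  map_smul' c m := by
    ext S
    simp only [Pi.smul_apply, RingHom.id_apply, Finset.smul_sum, mul_smul_comm]
    exact Finset.sum_congr rfl fun _ _ => smul_comm _ _ _

theorem wedge_apply (q : ℂ) {n : ℕ} (v : Fin n → A) (m : Finset (Fin n) → A)
    (S : Finset (Fin n)) :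
    wedge q v m S = ∑ j ∈ S, (-q) ^ (S.filter (· < j)).card • (v j * m (S.erase j)) := rfl

/-- The terms of the ordered pairs (j, l) and (l, j) are grouped. Taking the larger index first
costs one more factor -q, which produces a difference that the relations between the entries
control. -/
theorem wedge_wedge_apply (q : ℂ) {n : ℕ} (v w : Fin n → A) (m : Finset (Fin n) → A)
    (S : Finset (Fin n)) :
    wedge q v (wedge q w m) S = ∑ j ∈ S, ∑ l ∈ S, if j < l then
      (-q) ^ ((S.filter (· < j)).card + ((S.erase j).filter (· < l)).card) •
        ((v j * w l - q • (v l * w j)) * m ((S.erase j).erase l)) else 0 := by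
  let F : Fin n → Fin n → A := fun j l =>
    (-q) ^ ((S.filter (· < j)).card + ((S.erase j).filter (· < l)).card) •
        (v j * w l * m ((S.erase j).erase l))
  have h1 : wedge q v (wedge q w m) S = ∑ j ∈ S, ∑ l ∈ S, if l ≠ j then F j l else 0 := by
    rw [wedge_apply]
    refine Finset.sum_congr rfl fun j hj => ?_
    rw [wedge_apply, Finset.mul_sum, Finset.smul_sum, ← Finset.sum_filter, Finset.filter_ne']
    refine Finset.sum_congr rfl fun l hl => ?_
    simp [F, pow_add, mul_smul, mul_assoc]
  have h2 : ∀ j l, (if l ≠ j then F j l else 0) =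
      (if j < l then F j l else 0) + if l < j then F j l else 0 := by
    intro j l
    rcases lt_trichotomy j l with h | h | h
    · simp [h, h.ne', h.not_gt]
    · simp [h]
    · simp [h, h.ne, h.not_gt]
  have h3 : ∑ j ∈ S, ∑ l ∈ S, (if l < j then F j l else 0) =
      ∑ j ∈ S, ∑ l ∈ S, if j < l then F l j else 0 := Finset.sum_comm
  simp only [h1, h2, Finset.sum_add_distrib]
  rw [h3, ← Finset.sum_add_distrib]
  refine Finset.sum_congr rfl fun j hj => ?_
  rw [← Finset.sum_add_distrib]
  refine Finset.sum_congr rfl fun l hl => ?_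
  split_ifs with hjl
  · have e1 : (S.erase l).filter (· < j) = S.filter (· < j) := by
      ext a
      simp only [Finset.mem_filter, Finset.mem_erase]
      refine ⟨fun h => ⟨h.1.2, h.2⟩, fun h => ⟨⟨(h.2.trans hjl).ne, h.1⟩, h.2⟩⟩
    have e2 : (S.filter (· < l)).card = ((S.erase j).filter (· < l)).card + 1 := by
      rw [Finset.filter_erase, Finset.card_erase_add_one]
      simp [hj, hjl]
    simp only [F, e1, e2, Finset.erase_right_comm (a := l) (b := j)]
    rw [sub_mul, smul_sub, smul_mul_assoc, smul_smul, sub_eq_add_neg, ← neg_smul]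
    congr 2
    ring
  · simp

/-- `Pi.single ∅ 1` is the unit of the exterior algebra, so this reads off a coefficient of a
product of row forms; the induction is the Laplace expansion along the first row. -/
theorem list_prod_wedge_apply (q : ℂ) {n t : ℕ} (V : Fin t → Fin n → A) (c : Fin t → Fin n)
    (hc : StrictMono c) :
    ((List.ofFn fun a => wedge q (V a)).prod (Pi.single ∅ 1)) (Finset.univ.image c) =
      qDet q (Matrix.of fun a b => V a (c b)) := by
  induction t with
  | zero => simp [qDet, permLength]
  | succ t ih =>
    rw [List.ofFn_succ, List.prod_cons, Module.End.mul_apply, wedge_apply,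
      Finset.sum_image hc.injective.injOn, qDet_succ_row_zero]
    refine Finset.sum_congr rfl fun j _ => ?_
    have e1 : (Finset.univ.image c).erase (c j) = Finset.univ.image (c ∘ j.succAbove) := by
      rw [← Finset.image_image, Fin.image_succAbove_univ, ← Finset.image_erase hc.injective]
      congr 1
      ext; simp
    have e2 : ((Finset.univ.image c).filter (· < c j)).card = j := by
      rw [Finset.filter_image, Finset.card_image_of_injective _ hc.injective]
      simp [hc.lt_iff_lt, Finset.filter_gt_eq_Iio]
    rw [e1, e2, ih _ _ (hc.comp (Fin.strictMono_succAbove j))]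
    rfl

end Wedge

namespace IsQMatrix

variable {A : Type*} [Ring A] [Algebra ℂ A] {q : ℂ} {m n : ℕ} {X : Matrix (Fin m) (Fin n) A}

theorem wedge_mul_self (h : IsQMatrix q X) (i : Fin m) : wedge q (X i) * wedge q (X i) = 0 := by
  refine LinearMap.ext fun f => funext fun S => ?_
  simp only [Module.End.mul_apply, wedge_wedge_apply, LinearMap.zero_apply, Pi.zero_apply]
  refine Finset.sum_eq_zero fun j _ => Finset.sum_eq_zero fun l _ => ?_
  split_ifs with hjl
  · simp [h.row hjl]
  · rfl

/-- Row forms satisfy the relations of the exterior generators themselves; this encodes `diag` and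
`anti`, as `wedge_mul_self` encodes `row`. -/
theorem wedge_mul_of_lt (h : IsQMatrix q X) (hq : q ≠ 0) {i k : Fin m} (hik : i < k) :
    wedge q (X k) * wedge q (X i) = (-q) • (wedge q (X i) * wedge q (X k)) := by
  refine LinearMap.ext fun f => funext fun S => ?_
  simp only [Module.End.mul_apply, wedge_wedge_apply, LinearMap.smul_apply, Pi.smul_apply,
    Finset.smul_sum]
  refine Finset.sum_congr rfl fun j _ => Finset.sum_congr rfl fun l _ => ?_
  split_ifs with hjl
  · have key : X k j * X i l - q • (X k l * X i j) =
        (-q) • (X i j * X k l - q • (X i l * X k j)) := by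
      rw [h.diag hik hjl, h.anti hik hjl]
      match_scalars <;> field_simp <;> ring
    rw [key, smul_mul_assoc, smul_comm]
  · simp

theorem wedge_mul_list_prod (h : IsQMatrix q X) (hq : q ≠ 0) {k : Fin m} (l : List (Fin m))
    (hl : ∀ i ∈ l, i < k) :
    wedge q (X k) * (l.map fun i => wedge q (X i)).prod =
      (-q) ^ l.length • ((l.map fun i => wedge q (X i)).prod * wedge q (X k)) := by
  induction l with
  | nil => simp
  | cons i l ih =>
    rw [List.map_cons, List.prod_cons, ← mul_assoc, h.wedge_mul_of_lt hq (hl i (by simp)),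
      smul_mul_assoc, mul_assoc, ih fun a ha => hl a (by simp [ha])]
    rw [mul_smul_comm, smul_smul, ← pow_succ', List.length_cons, mul_assoc]

theorem list_prod_mul_wedge (h : IsQMatrix q X) (hq : q ≠ 0) {k : Fin m} (l : List (Fin m))
    (hl : ∀ i ∈ l, k < i) :
    (l.map fun i => wedge q (X i)).prod * wedge q (X k) =
      (-q) ^ l.length • (wedge q (X k) * (l.map fun i => wedge q (X i)).prod) := by
  induction l with
  | nil => simp
  | cons i l ih =>
    rw [List.map_cons, List.prod_cons, mul_assoc, ih fun a ha => hl a (by simp [ha]),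
      mul_smul_comm, ← mul_assoc, h.wedge_mul_of_lt hq (hl i (by simp))]
    rw [smul_mul_assoc, smul_smul, ← pow_succ, List.length_cons, mul_assoc]

end IsQMatrix

/-- Locates row `k` in the ordered product of all rows; the lengths of the two pieces are the powers
of -q picked up on moving row `k` to either end. -/
theorem finRange_split {t : ℕ} (k : Fin (t + 1)) : ∃ l₁ l₂ : List (Fin (t + 1)),
    List.finRange (t + 1) = l₁ ++ k :: l₂ ∧ (List.finRange t).map k.succAbove = l₁ ++ l₂ ∧
      l₁.length = k ∧ l₂.length = t - k ∧ (∀ i ∈ l₁, i < k) ∧ ∀ i ∈ l₂, k < i := by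
  obtain ⟨l₁, l₂, h⟩ := List.append_of_mem (List.mem_finRange k)
  have hs := List.pairwise_lt_finRange (t + 1)
  have hk : l₁.length = k := by
    have h1 : (List.finRange (t + 1))[l₁.length]? = some k := by rw [h]; simp
    rw [List.getElem?_eq_some_iff] at h1
    obtain ⟨_, h2⟩ := h1
    simpa using congrArg Fin.val h2
  have hlen := congrArg List.length h
  simp only [List.length_finRange, List.length_append, List.length_cons] at hlen
  rw [h, List.pairwise_append, List.pairwise_cons] at hs
  refine ⟨l₁, l₂, h, ?_, hk, by omega, fun i hi => hs.2.2 i hi k (by simp), hs.2.1.1⟩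
  have hs' : (l₁ ++ l₂).Pairwise (· < ·) := List.pairwise_append.2
    ⟨hs.1, hs.2.1.2, fun a ha b hb => hs.2.2 a ha b (by simp [hb])⟩
  have hm : ((List.finRange t).map k.succAbove).Pairwise (· < ·) :=
    List.pairwise_map.2 ((List.pairwise_lt_finRange t).imp fun h =>
      Fin.strictMono_succAbove k h)
  refine List.Perm.eq_of_pairwise' hm hs' ?_
  rw [List.perm_ext_iff_of_nodup (hm.imp ne_of_lt) (hs'.imp ne_of_lt)]
  intro a
  have ha := List.mem_finRange a
  rw [h] at ha
  have h1 : k ∉ l₁ := fun hk => lt_irrefl _ (hs.2.2 k hk k (by simp))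
  have h2 : k ∉ l₂ := fun hk => lt_irrefl _ (hs.2.1.1 k hk)
  have h3 : (∃ c, k.succAbove c = a) ↔ a ≠ k := Fin.exists_succAbove_eq_iff
  simp only [List.mem_map, List.mem_finRange, true_and, h3, List.mem_append]
  simp only [List.mem_append, List.mem_cons] at ha
  grind

/-! ### The quantum Cramer rule and centrality of the determinant -/

namespace IsQMatrix

variable {A : Type*} [Ring A] [Algebra ℂ A] {q : ℂ} {t : ℕ}
  {X : Matrix (Fin (t + 1)) (Fin (t + 1)) A}

theorem list_prod_wedge_finRange (X : Matrix (Fin (t + 1)) (Fin (t + 1)) A) :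
    ((List.finRange (t + 1)).map fun i => wedge q (X i)).prod (Pi.single ∅ 1) Finset.univ =
      qDet q X := by
  have := list_prod_wedge_apply q X id strictMono_id
  rw [Finset.image_id] at this
  rw [← List.ofFn_eq_map, this]
  rfl

/-- The left side is the top coefficient of row form `i` times the product of all row forms except
the `k`-th. If i = k, row `i` moves into its place past the `k` smaller rows; otherwise it meets its
own copy, and its square is zero. -/
theorem sum_mul_qDet_submatrix (h : IsQMatrix q X) (hq : q ≠ 0) (i k : Fin (t + 1)) :
    ∑ j : Fin (t + 1), (-q) ^ (j : ℕ) •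
      (X i j * qDet q (X.submatrix k.succAbove j.succAbove)) =
      if i = k then (-q) ^ (k : ℕ) • qDet q X else 0 := by
  have h1 := list_prod_wedge_apply q (Fin.cons (X i) fun a => X (k.succAbove a)) id strictMono_id
  rw [qDet_succ_row_zero, Finset.image_id, List.ofFn_succ, List.prod_cons] at h1
  simp only [Fin.cons_zero, Fin.cons_succ] at h1
  refine Eq.trans ?_ (h1.symm.trans ?_)
  · rfl
  have h2 : (List.ofFn fun a => wedge q (X (k.succAbove a))) =
      ((List.finRange t).map k.succAbove).map fun i => wedge q (X i) := by
    simp [List.ofFn_eq_map, Function.comp_def]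
  rw [h2]
  split_ifs with hik
  · subst hik
    obtain ⟨l₁, l₂, hf, hl, hc, -, hl₁, -⟩ := finRange_split i
    rw [hl, List.map_append, List.prod_append, ← mul_assoc, h.wedge_mul_list_prod hq l₁ hl₁,
      ← list_prod_wedge_finRange X, hf, hc]
    simp [mul_assoc]
  · have hm : ((List.finRange t).map k.succAbove).Pairwise (· < ·) :=
      List.pairwise_map.2 ((List.pairwise_lt_finRange t).imp fun h =>
        Fin.strictMono_succAbove k h)
    have hi : i ∈ (List.finRange t).map k.succAbove := by
      obtain ⟨c, hc⟩ := Fin.exists_succAbove_eq hik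
      exact List.mem_map.2 ⟨c, List.mem_finRange c, hc⟩
    obtain ⟨l₁, l₂, hl⟩ := List.append_of_mem hi
    rw [hl, List.pairwise_append] at hm
    rw [hl, List.map_append, List.prod_append, ← mul_assoc,
      h.wedge_mul_list_prod hq l₁ fun a ha => hm.2.2 a ha i (by simp), List.map_cons,
      List.prod_cons, smul_mul_assoc, mul_assoc, ← mul_assoc (wedge q (X i)), h.wedge_mul_self]
    simp

theorem sum_qDet_submatrix_mul (h : IsQMatrix q X) (hq : q ≠ 0) (i k : Fin (t + 1)) :
    ∑ j : Fin (t + 1), (-q) ^ (t - (j : ℕ)) •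
      (qDet q (X.submatrix k.succAbove j.succAbove) * X i j) =
      if i = k then (-q) ^ (t - (k : ℕ)) • qDet q X else 0 := by
  have h1 := list_prod_wedge_apply q
    (Fin.snoc (α := fun _ => Fin (t + 1) → A) (fun a => X (k.succAbove a)) (X i)) id strictMono_id
  rw [qDet_succ_row_last, Finset.image_id, List.ofFn_succ', List.concat_eq_append,
    List.prod_append, List.prod_singleton] at h1
  simp only [Fin.snoc_castSucc, Fin.snoc_last] at h1
  refine Eq.trans ?_ (h1.symm.trans ?_)
  · refine Finset.sum_congr rfl fun j _ => ?_
    congr 2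
    · congr 1
      ext a b
      simp
    · simp
  have h2 : (List.ofFn fun a => wedge q (X (k.succAbove a))) =
      ((List.finRange t).map k.succAbove).map fun i => wedge q (X i) := by
    simp [List.ofFn_eq_map, Function.comp_def]
  rw [h2]
  split_ifs with hik
  · subst hik
    obtain ⟨l₁, l₂, hf, hl, -, hc, -, hl₂⟩ := finRange_split i
    rw [hl, List.map_append, List.prod_append, mul_assoc, h.list_prod_mul_wedge hq l₂ hl₂,
      ← list_prod_wedge_finRange X, hf, hc]
    simp
  · have hm : ((List.finRange t).map k.succAbove).Pairwise (· < ·) :=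
      List.pairwise_map.2 ((List.pairwise_lt_finRange t).imp fun h =>
        Fin.strictMono_succAbove k h)
    have hi : i ∈ (List.finRange t).map k.succAbove := by
      obtain ⟨c, hc⟩ := Fin.exists_succAbove_eq hik
      exact List.mem_map.2 ⟨c, List.mem_finRange c, hc⟩
    obtain ⟨l₁, l₂, hl⟩ := List.append_of_mem hi
    rw [hl, List.pairwise_append, List.pairwise_cons] at hm
    rw [hl, List.map_append, List.prod_append, List.map_cons, List.prod_cons, mul_assoc, mul_assoc,
      h.list_prod_mul_wedge hq l₂ hm.2.1.1, mul_smul_comm, ← mul_assoc (wedge q (X i)),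
      h.wedge_mul_self]
    simp

/-- The quantum adjugate `Y` is a two-sided inverse of `X` up to the scalar matrix of the
determinant, so (XY)X = X(YX) compares the determinant on the two sides of each entry. -/
theorem commute_qDet_succ (h : IsQMatrix q X) (hq : q ≠ 0) (i l : Fin (t + 1)) :
    X i l * qDet q X = qDet q X * X i l := by
  have hq' : -q ≠ 0 := neg_ne_zero.2 hq
  let Y : Matrix (Fin (t + 1)) (Fin (t + 1)) A := fun j k =>
    ((-q) ^ (j : ℕ) * ((-q) ^ (k : ℕ))⁻¹) • qDet q (X.submatrix k.succAbove j.succAbove)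
  have h1 : X * Y = Matrix.diagonal fun _ => qDet q X := by
    ext i k
    rw [Matrix.mul_apply, Matrix.diagonal_apply]
    have := congrArg (fun a => ((-q) ^ (k : ℕ))⁻¹ • a) (h.sum_mul_qDet_submatrix hq i k)
    simp only [Finset.smul_sum, smul_ite, smul_zero, smul_smul] at this
    rw [inv_mul_cancel₀ (pow_ne_zero _ hq'), one_smul] at this
    rw [← this]
    refine Finset.sum_congr rfl fun j _ => ?_
    rw [mul_smul_comm, mul_comm]
  -- Expanding along columns is expanding the transpose along rows. The expansion with the minors on
  -- the left has exponents t - j and t - k, whose difference k - j agrees with the scaling in `Y`.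
  have h2 : Y * X = Matrix.diagonal fun _ => qDet q X := by
    ext k i
    rw [Matrix.mul_apply, Matrix.diagonal_apply]
    have := congrArg (fun a => ((-q) ^ (t - (k : ℕ)))⁻¹ • a)
      (h.transpose.sum_qDet_submatrix_mul hq i k)
    simp only [Finset.smul_sum, smul_ite, smul_zero, smul_smul, h.qDet_transpose] at this
    rw [inv_mul_cancel₀ (pow_ne_zero _ hq'), one_smul] at this
    simp only [eq_comm (a := k)]
    rw [← this]
    refine Finset.sum_congr rfl fun j _ => ?_
    rw [← Matrix.transpose_submatrix, (h.submatrix (Fin.strictMono_succAbove j)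
      (Fin.strictMono_succAbove k)).qDet_transpose, smul_mul_assoc, Matrix.transpose_apply]
    congr 1
    have hk : (-q) ^ t = (-q) ^ (t - (k : ℕ)) * (-q) ^ (k : ℕ) := by
      rw [← pow_add]; congr 1; omega
    have hj : (-q) ^ t = (-q) ^ (t - (j : ℕ)) * (-q) ^ (j : ℕ) := by
      rw [← pow_add]; congr 1; omega
    field_simp
    rw [mul_comm, ← hk, hj, mul_comm]
  have h3 := congrFun (congrFun (mul_assoc X Y X) i) l
  rw [h1, h2] at h3
  simpa using h3.symm

end IsQMatrix

theorem IsQMatrix.commute_qDet {A : Type*} [Ring A] [Algebra ℂ A] {q : ℂ} {n : ℕ}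
    {X : Matrix (Fin n) (Fin n) A} (h : IsQMatrix q X) (hq : q ≠ 0) (i l : Fin n) :
    X i l * qDet q X = qDet q X * X i l := by
  cases n with
  | zero => exact i.elim0
  | succ t => exact h.commute_qDet_succ hq i l

/-- An induction principle for the quantized coordinate ring of matrices. -/
theorem OqM.induction {n : ℕ} {q : ℂ} {P : OqM n q → Prop} (one : P 1)
    (smul : ∀ (c : ℂ) a, P a → P (c • a)) (add : ∀ a b, P a → P b → P (a + b))
    (mul : ∀ i j a, P a → P (genX n q i j * a)) (a : OqM n q) : P a := by
  obtain ⟨a, rfl⟩ := mkM_surjective n q a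
  suffices ∀ b, P b → P (mkM n q a * b) by simpa using this 1 one
  induction a using FreeAlgebra.induction with
  | grade0 r => intro b hb; simpa [Algebra.smul_def] using smul r b hb
  | grade1 x => intro b hb; exact mul x.1 x.2 b hb
  | mul a b ha hb => intro c hc; rw [map_mul, mul_assoc]; exact ha _ (hb _ hc)
  | add a b ha hb => intro c hc; rw [map_add, add_mul]; exact add _ _ (ha _ hc) (hb _ hc)

theorem commute_detM {n : ℕ} {q : ℂ} (hq : q ≠ 0) (a : OqM n q) : Commute (detM n q) a := by
  induction a using OqM.induction with
  | one => exact Commute.one_right _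
  | smul c a ha => exact ha.smul_right c
  | add a b ha hb => exact ha.add_right hb
  | mul i j a ha =>
    exact Commute.mul_right ((isQMatrix_genX n q).commute_qDet hq i j).symm ha

/-! ### The automorphism and derivation attached to one entry -/

/-- The relations between the generators of the subalgebra of quantum matrices that is generated by
the entries in the positions `U`, a final segment for the lexicographic order. -/
structure IsQMatrixOn (q : ℂ) {A : Type*} [Ring A] [Algebra ℂ A] {n : ℕ} (U : Set (Fin n × Fin n))
    (X : Matrix (Fin n) (Fin n) A) : Prop where
  diag : ∀ ⦃i j k l⦄, (i, j) ∈ U → i < k → j < l →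
    X i j * X k l = X k l * X i j + (q - q⁻¹) • (X i l * X k j)
  row : ∀ ⦃i j l⦄, j < l → X i j * X i l = q • (X i l * X i j)
  col : ∀ ⦃i j k⦄, i < k → X i j * X k j = q • (X k j * X i j)
  anti : ∀ ⦃i j k l⦄, i < k → l < j → X i j * X k l = X k l * X i j
  zero : ∀ ⦃i j⦄, (i, j) ∉ U → X i j = 0

/-- The positions after `p` in the lexicographic order. -/
def lexGT {n : ℕ} (p : Fin n × Fin n) : Set (Fin n × Fin n) :=
  {r | p.1 < r.1 ∨ (p.1 = r.1 ∧ p.2 < r.2)}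

namespace IsQMatrixOn

variable {q : ℂ} {A : Type*} [Ring A] [Algebra ℂ A] {n : ℕ} {X : Matrix (Fin n) (Fin n) A}

section Reorder

variable {U : Set (Fin n × Fin n)} {i j k l : Fin n}

/-- This and the following rules are oriented: each moves the lexicographically smaller entry to the
left, and the `_assoc` forms do so inside right-nested products. `simp` can then straighten words.
-/
theorem row_rev (h : IsQMatrixOn q U X) (hq : q ≠ 0) (hjl : j < l) :
    X i l * X i j = q⁻¹ • (X i j * X i l) := by
  rw [h.row hjl, smul_smul, inv_mul_cancel₀ hq, one_smul]

theorem col_rev (h : IsQMatrixOn q U X) (hq : q ≠ 0) (hik : i < k) :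
    X k j * X i j = q⁻¹ • (X i j * X k j) := by
  rw [h.col hik, smul_smul, inv_mul_cancel₀ hq, one_smul]

/-- The scalar `1` keeps `simp` from treating this as a permutation lemma. -/
theorem anti_rev (h : IsQMatrixOn q U X) (hik : i < k) (hlj : l < j) :
    X k l * X i j = (1 : ℂ) • (X i j * X k l) := by rw [one_smul, h.anti hik hlj]

theorem diag_rev (h : IsQMatrixOn q U X) (hU : (i, j) ∈ U) (hik : i < k) (hjl : j < l) :
    X k l * X i j = X i j * X k l - (q - q⁻¹) • (X i l * X k j) := by
  rw [h.diag hU hik hjl, add_sub_cancel_right]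

theorem row_rev_assoc (h : IsQMatrixOn q U X) (hq : q ≠ 0) (hjl : j < l) (r : A) :
    X i l * (X i j * r) = q⁻¹ • (X i j * (X i l * r)) := by
  rw [← mul_assoc, h.row_rev hq hjl, smul_mul_assoc, mul_assoc]

theorem col_rev_assoc (h : IsQMatrixOn q U X) (hq : q ≠ 0) (hik : i < k) (r : A) :
    X k j * (X i j * r) = q⁻¹ • (X i j * (X k j * r)) := by
  rw [← mul_assoc, h.col_rev hq hik, smul_mul_assoc, mul_assoc]

theorem anti_rev_assoc (h : IsQMatrixOn q U X) (hik : i < k) (hlj : l < j) (r : A) :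
    X k l * (X i j * r) = (1 : ℂ) • (X i j * (X k l * r)) := by
  rw [← mul_assoc, h.anti_rev hik hlj, smul_mul_assoc, mul_assoc]

end Reorder

/-- The values on generators of the derivation in the Ore extension by the entry at `p`. -/
def oreDelta (q : ℂ) (X : Matrix (Fin n) (Fin n) A) (p : Fin n × Fin n) :
    Matrix (Fin n) (Fin n) A :=
  fun k l => if p.1 < k ∧ p.2 < l then (q - q⁻¹) • (X p.1 l * X k p.2) else 0

/-- The scalars in the automorphism in the Ore extension by the entry at `p`. -/
def oreScalar (q : ℂ) (p : Fin n × Fin n) (k l : Fin n) : ℂ := if k = p.1 ∨ l = p.2 then q else 1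

theorem mem_lexGT_of_lt {p : Fin n × Fin n} {a b : Fin n} (h : p.1 < a) : (a, b) ∈ lexGT p :=
  Or.inl h

theorem mem_lexGT_of_eq {p : Fin n × Fin n} {b : Fin n} (h : p.2 < b) : (p.1, b) ∈ lexGT p :=
  Or.inr ⟨rfl, h⟩

section ReorderLex

variable {p : Fin n × Fin n} {i j k l : Fin n}

theorem diag_rev_lt (h : IsQMatrixOn q (lexGT p) X) (hi : p.1 < i) (hik : i < k) (hjl : j < l) :
    X k l * X i j = X i j * X k l - (q - q⁻¹) • (X i l * X k j) :=
  h.diag_rev (mem_lexGT_of_lt hi) hik hjl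

theorem diag_rev_eq (h : IsQMatrixOn q (lexGT p) X) (hj : p.2 < j) (hik : p.1 < k) (hjl : j < l) :
    X k l * X p.1 j = X p.1 j * X k l - (q - q⁻¹) • (X p.1 l * X k j) :=
  h.diag_rev (mem_lexGT_of_eq hj) hik hjl

theorem diag_rev_eq_assoc (h : IsQMatrixOn q (lexGT p) X) (hj : p.2 < j) (hik : p.1 < k)
    (hjl : j < l) (r : A) :
    X k l * (X p.1 j * r) = X p.1 j * (X k l * r) - (q - q⁻¹) • (X p.1 l * (X k j * r)) := by
  rw [← mul_assoc, h.diag_rev_eq hj hik hjl, sub_mul, smul_mul_assoc, mul_assoc, mul_assoc]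

end ReorderLex

section Values

variable {p : Fin n × Fin n} {k l : Fin n}

theorem oreDelta_of_lt (hk : p.1 < k) (hl : p.2 < l) :
    oreDelta q X p k l = (q - q⁻¹) • (X p.1 l * X k p.2) := if_pos ⟨hk, hl⟩

theorem oreDelta_left : oreDelta q X p p.1 l = 0 := if_neg fun h => lt_irrefl _ h.1

theorem oreDelta_right : oreDelta q X p k p.2 = 0 := if_neg fun h => lt_irrefl _ h.2

theorem oreDelta_of_gt (hl : l < p.2) : oreDelta q X p k l = 0 := if_neg fun h => hl.not_gt h.2

theorem oreScalar_left : oreScalar q p p.1 l = q := if_pos (Or.inl rfl)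

theorem oreScalar_right : oreScalar q p k p.2 = q := if_pos (Or.inr rfl)

theorem oreScalar_of_lt (hk : p.1 < k) (hl : p.2 < l) : oreScalar q p k l = 1 :=
  if_neg fun h => h.elim hk.ne' hl.ne'

theorem oreScalar_of_gt (hk : p.1 < k) (hl : l < p.2) : oreScalar q p k l = 1 :=
  if_neg fun h => h.elim hk.ne' hl.ne

end Values

theorem position_of_lt (i : Fin n) {b d : Fin n} (h : b < d) :
    (i < b ∧ i < d) ∨ i = b ∨ (b < i ∧ i < d) ∨ i = d ∨ (b < i ∧ d < i) := by
  grind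

-- A τ-derivation δ with the prescribed values must respect this relation: both sides are τ(a)δ(b) +
-- δ(a)b for the two sides of the row relation. The position relative to `p` decides which values
-- are nonzero; straightening then reduces each case to an identity of scalars. The next three
-- lemmas do the same for the other relations.
set_option linter.unusedSimpArgs false in
theorem oreDelta_row {p : Fin n × Fin n} (h : IsQMatrixOn q (lexGT p) X) (hq : q ≠ 0)
    {a b d : Fin n} (hbd : b < d) (hab : (a, b) ∈ lexGT p) :
    oreScalar q p a b • X a b * oreDelta q X p a d + oreDelta q X p a b * X a d =
      q • (oreScalar q p a d • X a d * oreDelta q X p a b + oreDelta q X p a d * X a b) := by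
  obtain ha | ⟨rfl, hb⟩ : p.1 < a ∨ p.1 = a ∧ p.2 < b := hab
  on_goal 1 => obtain ⟨hb, hd⟩ | rfl | ⟨hb, hd⟩ | rfl | ⟨hb, hd⟩ := position_of_lt p.2 hbd
  all_goals
    simp (disch := assumption) only [oreDelta_of_lt, oreDelta_left, oreDelta_right,
      oreDelta_of_gt, oreScalar_left, oreScalar_right, oreScalar_of_lt, oreScalar_of_gt, mul_zero,
      zero_mul, add_zero, zero_add, smul_zero, one_smul, smul_mul_assoc, mul_smul_comm, mul_assoc,
      mul_sub, smul_add, smul_sub, h.row_rev hq, h.row_rev_assoc hq, h.col_rev hq,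
      h.col_rev_assoc hq, h.anti_rev, h.anti_rev_assoc, h.diag_rev_lt, h.diag_rev_eq,
      h.diag_rev_eq_assoc]
    try match_scalars <;> field_simp <;> ring

set_option linter.unusedSimpArgs false in
theorem oreDelta_col {p : Fin n × Fin n} (h : IsQMatrixOn q (lexGT p) X) (hq : q ≠ 0)
    {a b c : Fin n} (hac : a < c) (hab : (a, b) ∈ lexGT p) :
    oreScalar q p a b • X a b * oreDelta q X p c b + oreDelta q X p a b * X c b =
      q • (oreScalar q p c b • X c b * oreDelta q X p a b + oreDelta q X p c b * X a b) := by
  obtain ha | ⟨rfl, hb⟩ : p.1 < a ∨ p.1 = a ∧ p.2 < b := hab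
  on_goal 1 =>
    have hc := ha.trans hac
    rcases lt_trichotomy p.2 b with hb | rfl | hb
  all_goals
    simp (disch := assumption) only [oreDelta_of_lt, oreDelta_left, oreDelta_right,
      oreDelta_of_gt, oreScalar_left, oreScalar_right, oreScalar_of_lt, oreScalar_of_gt, mul_zero,
      zero_mul, add_zero, zero_add, smul_zero, one_smul, smul_mul_assoc, mul_smul_comm, mul_assoc,
      mul_sub, smul_add, smul_sub, h.row_rev hq, h.row_rev_assoc hq, h.col_rev hq,
      h.col_rev_assoc hq, h.anti_rev, h.anti_rev_assoc, h.diag_rev_lt, h.diag_rev_eq,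
      h.diag_rev_eq_assoc]
    try match_scalars <;> field_simp <;> ring

set_option linter.unusedSimpArgs false in
theorem oreDelta_anti {p : Fin n × Fin n} (h : IsQMatrixOn q (lexGT p) X) (hq : q ≠ 0)
    {a b c d : Fin n} (hac : a < c) (hdb : d < b) (hab : (a, b) ∈ lexGT p) :
    oreScalar q p a b • X a b * oreDelta q X p c d + oreDelta q X p a b * X c d =
      oreScalar q p c d • X c d * oreDelta q X p a b + oreDelta q X p c d * X a b := by
  obtain ha | ⟨rfl, hb⟩ : p.1 < a ∨ p.1 = a ∧ p.2 < b := hab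
  on_goal 2 => rcases lt_trichotomy p.2 d with hd | rfl | hd
  on_goal 1 =>
    have hc := ha.trans hac
    obtain ⟨hd, hb⟩ | rfl | ⟨hd, hb⟩ | rfl | ⟨hd, hb⟩ := position_of_lt p.2 hdb
  all_goals
    simp (disch := assumption) only [oreDelta_of_lt, oreDelta_left, oreDelta_right,
      oreDelta_of_gt, oreScalar_left, oreScalar_right, oreScalar_of_lt, oreScalar_of_gt, mul_zero,
      zero_mul, add_zero, zero_add, smul_zero, one_smul, smul_mul_assoc, mul_smul_comm, mul_assoc,
      mul_sub, smul_add, smul_sub, h.row_rev hq, h.row_rev_assoc hq, h.col_rev hq,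
      h.col_rev_assoc hq, h.anti_rev, h.anti_rev_assoc, h.diag_rev_lt, h.diag_rev_eq,
      h.diag_rev_eq_assoc]
    try match_scalars <;> field_simp <;> ring

set_option linter.unusedSimpArgs false in
theorem oreDelta_diag {p : Fin n × Fin n} (h : IsQMatrixOn q (lexGT p) X) (hq : q ≠ 0)
    {a b c d : Fin n} (hac : a < c) (hbd : b < d) (hab : (a, b) ∈ lexGT p) :
    oreScalar q p a b • X a b * oreDelta q X p c d + oreDelta q X p a b * X c d =
      oreScalar q p c d • X c d * oreDelta q X p a b + oreDelta q X p c d * X a b +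
      (q - q⁻¹) • (oreScalar q p a d • X a d * oreDelta q X p c b +
        oreDelta q X p a d * X c b) := by
  obtain ha | ⟨rfl, hb⟩ : p.1 < a ∨ p.1 = a ∧ p.2 < b := hab
  on_goal 2 => have hd := hb.trans hbd
  on_goal 1 =>
    have hc := ha.trans hac
    obtain ⟨hb, hd⟩ | rfl | ⟨hb, hd⟩ | rfl | ⟨hb, hd⟩ := position_of_lt p.2 hbd
  all_goals
    simp (disch := assumption) only [oreDelta_of_lt, oreDelta_left, oreDelta_right,
      oreDelta_of_gt, oreScalar_left, oreScalar_right, oreScalar_of_lt, oreScalar_of_gt, mul_zero,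
      zero_mul, add_zero, zero_add, smul_zero, one_smul, smul_mul_assoc, mul_smul_comm, mul_assoc,
      mul_sub, smul_add, smul_sub, h.row_rev hq, h.row_rev_assoc hq, h.col_rev hq,
      h.col_rev_assoc hq, h.anti_rev, h.anti_rev_assoc, h.diag_rev_lt, h.diag_rev_eq,
      h.diag_rev_eq_assoc]
    try match_scalars <;> field_simp <;> ring

/-- Only the diagonal relation mixes two different monomials; rescaling the entries preserves it
when both diagonals of a 2 × 2 block get the same product of scalars. -/
theorem oreScalar_mul_oreScalar {p : Fin n × Fin n} {a b c d : Fin n} (hac : a < c) (hbd : b < d)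
    (hab : (a, b) ∈ lexGT p) :
    oreScalar q p a d * oreScalar q p c b = oreScalar q p a b * oreScalar q p c d := by
  simp only [oreScalar]
  obtain ha | ⟨rfl, hb⟩ : p.1 < a ∨ p.1 = a ∧ p.2 < b := hab
  · simp [ha.ne', (ha.trans hac).ne', mul_comm]
  · simp [hac.ne', hb.ne', (hb.trans hbd).ne']

theorem smul {U : Set (Fin n × Fin n)} (h : IsQMatrixOn q U X) (c : Fin n → Fin n → ℂ)
    (hc : ∀ ⦃i j k l⦄, (i, j) ∈ U → i < k → j < l → c i l * c k j = c i j * c k l) :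
    IsQMatrixOn q U (fun i j => c i j • X i j : Matrix (Fin n) (Fin n) A) where
  diag i j k l hU hik hjl := by
    simp only [smul_mul_smul_comm, h.diag hU hik hjl, hc hU hik hjl]
    module
  row i j l hjl := by
    simp only [smul_mul_smul_comm, h.row hjl]
    module
  col i j k hik := by
    simp only [smul_mul_smul_comm, h.col hik]
    module
  anti i j k l hik hlj := by
    simp only [smul_mul_smul_comm, h.anti hik hlj, mul_comm]
  zero i j hU := by rw [h.zero hU, smul_zero]

/-- The upper triangular matrices that encode the automorphism and the derivation of the Ore
extension by the entry at `p`. -/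
def oreMatrix (q : ℂ) (X : Matrix (Fin n) (Fin n) A) (p : Fin n × Fin n) :
    Matrix (Fin n) (Fin n) (Matrix (Fin 2) (Fin 2) A) :=
  fun k l => !![oreScalar q p k l • X k l, oreDelta q X p k l; 0, X k l]

theorem upperTri_mul (a b d a' b' d' : A) :
    !![a, b; 0, d] * !![a', b'; 0, d'] = !![a * a', a * b' + b * d'; 0, d * d'] := by
  ext i j
  fin_cases i <;> fin_cases j <;> simp [Matrix.mul_apply]

theorem upperTri_add (a b d a' b' d' : A) :
    !![a, b; 0, d] + !![a', b'; 0, d'] = !![a + a', b + b'; 0, d + d'] := by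
  ext i j
  fin_cases i <;> fin_cases j <;> simp

theorem upperTri_smul (c : ℂ) (a b d : A) :
    c • !![a, b; 0, d] = !![c • a, c • b; 0, c • d] := by
  ext i j
  fin_cases i <;> fin_cases j <;> simp

/-- A map r ↦ (τ r, δ r; 0, r) is multiplicative exactly when τ is and δ is a τ-derivation. A
relation thus splits into one for rescaled entries, one for δ and the original one. -/
theorem oreMatrix_isQMatrixOn {p : Fin n × Fin n} (h : IsQMatrixOn q (lexGT p) X) (hq : q ≠ 0) :
    IsQMatrixOn q (lexGT p) (oreMatrix q X p) := by
  have hs := h.smul (oreScalar q p) fun i j k l hU hik hjl => oreScalar_mul_oreScalar hik hjl hU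
  have hz : ∀ ⦃k l⦄, (k, l) ∉ lexGT p → oreMatrix q X p k l = 0 := by
    intro k l hkl
    have : oreDelta q X p k l = 0 := if_neg fun h' => hkl (Or.inl h'.1)
    ext a b
    fin_cases a <;> fin_cases b <;> simp [oreMatrix, h.zero hkl, this]
  refine ⟨fun i j k l hU hik hjl => ?_, fun i j l hjl => ?_, fun i j k hik => ?_,
    fun i j k l hik hlj => ?_, hz⟩
  · have h1 := hs.diag hU hik hjl
    have h2 := h.diag hU hik hjl
    have h3 := h.oreDelta_diag hq hik hjl hU
    simp only [oreMatrix, upperTri_mul, upperTri_add, upperTri_smul]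
    rw [h1, h2, h3]
  · by_cases hU : (i, j) ∈ lexGT p
    · have h1 := hs.row (i := i) hjl
      have h2 := h.row (i := i) hjl
      have h3 := h.oreDelta_row hq hjl hU
      simp only [oreMatrix, upperTri_mul, upperTri_smul]
      rw [h1, h2, h3]
    · simp [hz hU]
  · by_cases hU : (i, j) ∈ lexGT p
    · have h1 := hs.col (j := j) hik
      have h2 := h.col (j := j) hik
      have h3 := h.oreDelta_col hq hik hU
      simp only [oreMatrix, upperTri_mul, upperTri_smul]
      rw [h1, h2, h3]
    · simp [hz hU]
  · by_cases hU : (i, j) ∈ lexGT p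
    · have h1 := hs.anti hik hlj
      have h2 := h.anti hik hlj
      have h3 := h.oreDelta_anti hq hik hlj hU
      simp only [oreMatrix, upperTri_mul]
      rw [h1, h2, h3]
    · simp [hz hU]

end IsQMatrixOn

/-! ### Ore extensions -/

open Polynomial

section Ore

variable {R A : Type*} [Ring R] [Algebra ℂ R] [Ring A] [Algebra ℂ A]

/-- Left multiplication by the variable of the Ore extension `R[x; τ, δ]`, on polynomials with
coefficients written on the left. -/
def oreMulX (τ : R →ₐ[ℂ] R) (δ : R →ₗ[ℂ] R) : Module.End ℂ R[X] :=
  Polynomial.lsum fun k =>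
    (monomial (k + 1)).restrictScalars ℂ ∘ₗ τ.toLinearMap + (monomial k).restrictScalars ℂ ∘ₗ δ

theorem oreMulX_monomial (τ : R →ₐ[ℂ] R) (δ : R →ₗ[ℂ] R) (k : ℕ) (r : R) :
    oreMulX τ δ (monomial k r) = monomial (k + 1) (τ r) + monomial k (δ r) := by
  simp [oreMulX, Polynomial.lsum_apply, Polynomial.sum_monomial_index]

theorem coeff_oreMulX_succ (τ : R →ₐ[ℂ] R) (δ : R →ₗ[ℂ] R) (f : R[X]) (k : ℕ) :
    (oreMulX τ δ f).coeff (k + 1) = τ (f.coeff k) + δ (f.coeff (k + 1)) := by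
  induction f using Polynomial.induction_on' with
  | add f g hf hg => simp only [map_add, coeff_add, hf, hg]; abel
  | monomial m r =>
    simp only [oreMulX_monomial, coeff_add, coeff_monomial, add_left_inj]
    split_ifs <;> simp

theorem natDegree_oreMulX_le (τ : R →ₐ[ℂ] R) (δ : R →ₗ[ℂ] R) {f : R[X]} {N : ℕ}
    (hf : f.natDegree ≤ N) : (oreMulX τ δ f).natDegree ≤ N + 1 := by
  rw [natDegree_le_iff_coeff_eq_zero]
  intro m hm
  obtain ⟨k, rfl⟩ : ∃ k, m = k + 1 := ⟨m - 1, by omega⟩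
  rw [coeff_oreMulX_succ, coeff_eq_zero_of_natDegree_lt (by omega),
    coeff_eq_zero_of_natDegree_lt (by omega), map_zero, map_zero, add_zero]

theorem oreMulX_pow_natDegree_le_and_coeff (τ : R →ₐ[ℂ] R) (δ : R →ₗ[ℂ] R) {f : R[X]} {N : ℕ}
    (hf : f.natDegree ≤ N) (k : ℕ) : ((oreMulX τ δ ^ k) f).natDegree ≤ N + k ∧
      ((oreMulX τ δ ^ k) f).coeff (N + k) = (τ ^ k) (f.coeff N) := by
  induction k with
  | zero => simpa using hf
  | succ k ih =>
    rw [pow_succ', Module.End.mul_apply, ← add_assoc]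
    refine ⟨natDegree_oreMulX_le τ δ ih.1, ?_⟩
    rw [coeff_oreMulX_succ, ih.2, coeff_eq_zero_of_natDegree_lt (Nat.lt_succ_of_le ih.1), map_zero, add_zero,
      pow_succ', AlgHom.mul_apply]

/-- The product in the Ore extension `R[x; τ, δ]`. -/
def oreMul (τ : R →ₐ[ℂ] R) (δ : R →ₗ[ℂ] R) (f g : R[X]) : R[X] :=
  f.sum fun k r => C r * (oreMulX τ δ ^ k) g

theorem natDegree_oreMul_le (τ : R →ₐ[ℂ] R) (δ : R →ₗ[ℂ] R) (f g : R[X]) :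
    (oreMul τ δ f g).natDegree ≤ f.natDegree + g.natDegree := by
  refine natDegree_sum_le_of_forall_le _ _ fun k hk => ?_
  have h1 := (oreMulX_pow_natDegree_le_and_coeff τ δ (le_refl g.natDegree) k).1
  have h2 := le_natDegree_of_mem_supp k hk
  exact (natDegree_C_mul_le _ _).trans (by omega)

/-- Lower powers of the variable do not reach the top degree, so leading coefficients multiply up to
a power of τ. For injective τ this makes an Ore extension of a domain a domain. -/
theorem coeff_oreMul (τ : R →ₐ[ℂ] R) (δ : R →ₗ[ℂ] R) (f g : R[X]) :
    (oreMul τ δ f g).coeff (f.natDegree + g.natDegree) =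
      f.leadingCoeff * (τ ^ f.natDegree) g.leadingCoeff := by
  rw [oreMul, Polynomial.sum_def, finsetSum_coeff, Finset.sum_eq_single f.natDegree]
  · rw [coeff_C_mul, add_comm f.natDegree,
      (oreMulX_pow_natDegree_le_and_coeff τ δ le_rfl _).2, leadingCoeff, leadingCoeff]
  · intro k hk hk'
    have h1 := (oreMulX_pow_natDegree_le_and_coeff τ δ (le_refl g.natDegree) k).1
    have h2 := le_natDegree_of_mem_supp k hk
    rw [coeff_C_mul, coeff_eq_zero_of_natDegree_lt (p := (oreMulX τ δ ^ k) g) (by omega), mul_zero]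
  · intro h
    rw [notMem_support_iff.1 h, C_0, zero_mul, coeff_zero]

/-- `A` is the Ore extension of `R` by the variable `x`, with automorphism `τ` and
`τ`-derivation `δ`. -/
structure IsOreExtension (ι : R →ₐ[ℂ] A) (x : A) (τ : R →ₐ[ℂ] R) (δ : R →ₗ[ℂ] R) : Prop where
  comm : ∀ r, x * ι r = ι (τ r) * x + ι (δ r)
  bijective : Function.Bijective fun f : R[X] => f.eval₂ (ι : R →+* A) x

namespace IsOreExtension

variable {ι : R →ₐ[ℂ] A} {x : A} {τ : R →ₐ[ℂ] R} {δ : R →ₗ[ℂ] R}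

theorem mul_eval₂ (hc : ∀ r, x * ι r = ι (τ r) * x + ι (δ r)) (f : R[X]) :
    x * f.eval₂ (ι : R →+* A) x = (oreMulX τ δ f).eval₂ (ι : R →+* A) x := by
  induction f using Polynomial.induction_on' with
  | add f g hf hg => simp only [map_add, eval₂_add, mul_add, hf, hg]
  | monomial k r =>
    simp only [oreMulX_monomial, eval₂_add, eval₂_monomial, AlgHom.coe_toRingHom]
    rw [← mul_assoc, hc, add_mul, mul_assoc, ← pow_succ']

theorem algebraMap_mul_eval₂ (r : R) (f : R[X]) :
    ι r * f.eval₂ (ι : R →+* A) x = (C r * f).eval₂ (ι : R →+* A) x := by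
  induction f using Polynomial.induction_on' with
  | add f g hf hg => simp only [eval₂_add, mul_add, hf, hg]
  | monomial k r' => simp [eval₂_monomial, C_mul_monomial, mul_assoc]

/-- Carries the product of `A` over to polynomials, where degrees and leading coefficients are
available. -/
theorem eval₂_mul (hc : ∀ r, x * ι r = ι (τ r) * x + ι (δ r)) (f g : R[X]) :
    f.eval₂ (ι : R →+* A) x * g.eval₂ (ι : R →+* A) x =
      (oreMul τ δ f g).eval₂ (ι : R →+* A) x := by
  have hpow : ∀ k, x ^ k * g.eval₂ (ι : R →+* A) x =
      ((oreMulX τ δ ^ k) g).eval₂ (ι : R →+* A) x := by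
    intro k
    induction k with
    | zero => simp
    | succ k ih =>
      rw [pow_succ', mul_assoc, ih, mul_eval₂ hc, pow_succ', Module.End.mul_apply]
  rw [oreMul, Polynomial.sum_def, eval₂_finsetSum, eval₂_def, Polynomial.sum_def, Finset.sum_mul]
  refine Finset.sum_congr rfl fun k _ => ?_
  rw [mul_assoc, hpow, AlgHom.coe_toRingHom, algebraMap_mul_eval₂]

/-- A representation on `R[X]` by the formulas of the Ore extension shows that the powers of `x` are
linearly independent over `R`. -/
theorem of_representation (hc : ∀ r, x * ι r = ι (τ r) * x + ι (δ r)) (hδ : δ 1 = 0)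
    (hspan : ∀ P : Submodule ℂ A, 1 ∈ P → (∀ a ∈ P, x * a ∈ P) → (∀ r, ∀ a ∈ P, ι r * a ∈ P) →
      P = ⊤)
    (ρ : A →ₐ[ℂ] Module.End ℂ R[X]) (hρx : ρ x = oreMulX τ δ)
    (hρ : ∀ r f, ρ (ι r) f = C r * f) : IsOreExtension ι x τ δ := by
  refine ⟨hc, fun f g hfg => ?_, fun a => ?_⟩
  · have hpow : ∀ k, (oreMulX τ δ ^ k) (1 : R[X]) = monomial k 1 := by
      intro k
      induction k with
      | zero => simp
      | succ k ih => rw [pow_succ', Module.End.mul_apply, ih, oreMulX_monomial]; simp [hδ]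
    -- Acting on the vector 1 recovers the polynomial, hence injectivity.
    have key : ∀ f : R[X], ρ (f.eval₂ (ι : R →+* A) x) 1 = f := by
      intro f
      induction f using Polynomial.induction_on' with
      | add f g hf hg => rw [eval₂_add, map_add, LinearMap.add_apply, hf, hg]
      | monomial k r =>
        rw [eval₂_monomial, map_mul, map_pow, hρx, Module.End.mul_apply, hpow,
          AlgHom.coe_toRingHom, hρ, C_mul_monomial, mul_one]
    rw [← key f, ← key g]
    exact congrArg (fun a => ρ a 1) hfg
  · let P : Submodule ℂ A :=
      { carrier := Set.range fun f : R[X] => f.eval₂ (ι : R →+* A) x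
        add_mem' := by
          rintro _ _ ⟨f, rfl⟩ ⟨g, rfl⟩
          exact ⟨f + g, eval₂_add _ _⟩
        zero_mem' := ⟨0, eval₂_zero _ _⟩
        smul_mem' := by
          rintro c _ ⟨f, rfl⟩
          refine ⟨C (algebraMap ℂ R c) * f, ?_⟩
          simp only
          rw [← algebraMap_mul_eval₂, AlgHom.commutes, ← Algebra.smul_def] }
    have hP : P = ⊤ := by
      refine hspan P ⟨1, eval₂_one _ _⟩ ?_ ?_
      · rintro _ ⟨f, rfl⟩
        exact ⟨_, (mul_eval₂ hc f).symm⟩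
      · rintro r _ ⟨f, rfl⟩
        exact ⟨_, (algebraMap_mul_eval₂ r f).symm⟩
    have ha : a ∈ P := hP ▸ Submodule.mem_top
    exact ha

theorem noZeroDivisors (h : IsOreExtension ι x τ δ) (hτ : Function.Injective τ)
    [NoZeroDivisors R] : NoZeroDivisors A := by
  refine ⟨fun {a b} hab => ?_⟩
  obtain ⟨f, rfl⟩ := h.bijective.2 a
  obtain ⟨g, rfl⟩ := h.bijective.2 b
  simp only at hab ⊢
  rw [eval₂_mul h.comm] at hab
  have h0 : oreMul τ δ f g = 0 := h.bijective.1 (by simpa using hab)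
  have h1 := coeff_oreMul τ δ f g
  rw [h0, coeff_zero, eq_comm, mul_eq_zero] at h1
  have hτ' : Function.Injective ⇑(τ ^ f.natDegree) := by
    rw [AlgHom.coe_pow]
    exact hτ.iterate _
  rw [map_eq_zero_iff _ hτ', leadingCoeff_eq_zero, leadingCoeff_eq_zero] at h1
  rcases h1 with rfl | rfl
  · exact Or.inl (eval₂_zero _ _)
  · exact Or.inr (eval₂_zero _ _)

end IsOreExtension

end Ore

/-! ### Quantum matrices as an iterated Ore extension -/

/-- The positions from `p` on in the lexicographic order. -/
def lexGE {n : ℕ} (p : Fin n × Fin n) : Set (Fin n × Fin n) :=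
  {r | p.1 < r.1 ∨ (p.1 = r.1 ∧ p.2 ≤ r.2)}

/-- `A` is presented by the generators `X i j` and the relations `IsQMatrixOn q U`. -/
structure IsPresentedOn (q : ℂ) {n : ℕ} (U : Set (Fin n × Fin n)) {A : Type} [Ring A]
    [Algebra ℂ A] (X : Matrix (Fin n) (Fin n) A) : Prop where
  rel : IsQMatrixOn q U X
  span : ∀ P : Submodule ℂ A, 1 ∈ P → (∀ i j, ∀ a ∈ P, X i j * a ∈ P) → P = ⊤
  lift : ∀ {B : Type} [Ring B] [Algebra ℂ B] (Y : Matrix (Fin n) (Fin n) B), IsQMatrixOn q U Y →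
    ∃ f : A →ₐ[ℂ] B, ∀ i j, f (X i j) = Y i j

/-- The relations of `IsQMatrixOn` in the free algebra. -/
inductive OnRel (n : ℕ) (q : ℂ) (U : Set (Fin n × Fin n)) :
    FreeAlgebra ℂ (Fin n × Fin n) → FreeAlgebra ℂ (Fin n × Fin n) → Prop
  | diag (i j k l : Fin n) (hU : (i, j) ∈ U) (hik : i < k) (hjl : j < l) :
      OnRel n q U (freeX n i j * freeX n k l)
        (freeX n k l * freeX n i j + (q - q⁻¹) • (freeX n i l * freeX n k j))
  | row (i j l : Fin n) (hjl : j < l) :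
      OnRel n q U (freeX n i j * freeX n i l) (q • (freeX n i l * freeX n i j))
  | col (i j k : Fin n) (hik : i < k) :
      OnRel n q U (freeX n i j * freeX n k j) (q • (freeX n k j * freeX n i j))
  | anti (i j k l : Fin n) (hik : i < k) (hlj : l < j) :
      OnRel n q U (freeX n i j * freeX n k l) (freeX n k l * freeX n i j)
  | zero (i j : Fin n) (hU : (i, j) ∉ U) : OnRel n q U (freeX n i j) 0

theorem eq_top_of_mul_mem {n : ℕ} {A : Type} [Ring A] [Algebra ℂ A]
    (f : FreeAlgebra ℂ (Fin n × Fin n) →ₐ[ℂ] A) (hf : Function.Surjective f)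
    (P : Submodule ℂ A) (h1 : 1 ∈ P) (hP : ∀ i j, ∀ a ∈ P, f (freeX n i j) * a ∈ P) : P = ⊤ := by
  rw [eq_top_iff]
  rintro a -
  obtain ⟨a, rfl⟩ := hf a
  suffices ∀ b ∈ P, f a * b ∈ P by simpa using this 1 h1
  induction a using FreeAlgebra.induction with
  | grade0 r =>
    intro b hb
    rw [AlgHom.commutes, ← Algebra.smul_def]
    exact P.smul_mem r hb
  | grade1 x => exact hP x.1 x.2
  | mul a b ha hb => intro c hc; rw [map_mul, mul_assoc]; exact ha _ (hb _ hc)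
  | add a b ha hb => intro c hc; rw [map_add, add_mul]; exact P.add_mem (ha _ hc) (hb _ hc)

theorem exists_isPresentedOn (n : ℕ) (q : ℂ) (U : Set (Fin n × Fin n)) :
    ∃ (R : Type) (_ : Ring R) (_ : Algebra ℂ R) (X : Matrix (Fin n) (Fin n) R),
      IsPresentedOn q U X := by
  let mk := RingQuot.mkAlgHom ℂ (OnRel n q U)
  have hmk : ∀ ⦃a b⦄, OnRel n q U a b → mk a = mk b := fun a b h => RingQuot.mkAlgHom_rel ℂ h
  refine ⟨RingQuot (OnRel n q U), inferInstance, inferInstance, fun i j => mk (freeX n i j),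
    ⟨⟨fun i j k l hU hik hjl => ?_, fun i j l hjl => ?_, fun i j k hik => ?_,
      fun i j k l hik hlj => ?_, fun i j hU => ?_⟩,
      eq_top_of_mul_mem mk (RingQuot.mkAlgHom_surjective ℂ _), fun {B} _ _ Y hY => ?_⟩⟩
  · simpa using hmk (OnRel.diag i j k l hU hik hjl)
  · simpa using hmk (OnRel.row i j l hjl)
  · simpa using hmk (OnRel.col i j k hik)
  · simpa using hmk (OnRel.anti i j k l hik hlj)
  · simpa using hmk (OnRel.zero i j hU)
  · let F : FreeAlgebra ℂ (Fin n × Fin n) →ₐ[ℂ] B := FreeAlgebra.lift ℂ fun p => Y p.1 p.2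
    have hF : ∀ i j, F (freeX n i j) = Y i j := fun i j => by simp [F, freeX]
    refine ⟨RingQuot.liftAlgHom ℂ ⟨F, ?_⟩, fun i j => ?_⟩
    · rintro _ _ (⟨i, j, k, l, hU, hik, hjl⟩ | ⟨i, j, l, hjl⟩ | ⟨i, j, k, hik⟩ |
        ⟨i, j, k, l, hik, hlj⟩ | ⟨i, j, hU⟩)
      · simpa [hF] using hY.diag hU hik hjl
      · simpa [hF] using hY.row hjl
      · simpa [hF] using hY.col hik
      · simpa [hF] using hY.anti hik hlj
      · simpa [hF] using hY.zero hU
    · rw [← hF]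
      exact RingQuot.liftAlgHom_mkAlgHom_apply ℂ F _ _

/-- The homomorphism defined by a quantum matrix. -/
def OqM.lift {n : ℕ} {q : ℂ} {B : Type*} [Ring B] [Algebra ℂ B] (Y : Matrix (Fin n) (Fin n) B)
    (hY : IsQMatrix q Y) : OqM n q →ₐ[ℂ] B :=
  liftM (FreeAlgebra.lift ℂ fun p => Y p.1 p.2) <| by
    rintro _ _ (⟨i, j, k, l, hik, hjl⟩ | ⟨i, j, l, hjl⟩ | ⟨i, j, k, hik⟩ | ⟨i, j, k, l, hik, hlj⟩)
    · simpa [freeX] using hY.diag hik hjl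
    · simpa [freeX] using hY.row hjl
    · simpa [freeX] using hY.col hik
    · simpa [freeX] using hY.anti hik hlj

@[simp]
theorem OqM.lift_genX {n : ℕ} {q : ℂ} {B : Type*} [Ring B] [Algebra ℂ B]
    (Y : Matrix (Fin n) (Fin n) B) (hY : IsQMatrix q Y) (i j : Fin n) :
    OqM.lift Y hY (genX n q i j) = Y i j := by
  rw [OqM.lift, genX, liftM_mk]
  simp [freeX]

theorem isPresentedOn_genX (n : ℕ) (q : ℂ) : IsPresentedOn q Set.univ (genX n q) where
  rel :=
    { diag := fun _ _ _ _ _ hik hjl => (isQMatrix_genX n q).diag hik hjl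
      row := (isQMatrix_genX n q).row
      col := (isQMatrix_genX n q).col
      anti := (isQMatrix_genX n q).anti
      zero := fun _ _ h => (h trivial).elim }
  span P h1 hP := eq_top_of_mul_mem (mkM n q) (mkM_surjective n q) P h1 hP
  lift Y hY := ⟨OqM.lift Y ⟨fun _ _ _ _ hik hjl => hY.diag trivial hik hjl, hY.row, hY.col,
    hY.anti⟩, OqM.lift_genX Y _⟩

namespace IsPresentedOn

variable {q : ℂ} {n : ℕ} {U : Set (Fin n × Fin n)} {A : Type} [Ring A] [Algebra ℂ A]
  {X : Matrix (Fin n) (Fin n) A}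

theorem hom_ext (h : IsPresentedOn q U X) {B : Type*} [Ring B] [Algebra ℂ B] {f g : A →ₐ[ℂ] B}
    (hfg : ∀ i j, f (X i j) = g (X i j)) : f = g := by
  have := h.span (LinearMap.eqLocus f.toLinearMap g.toLinearMap) (by simp) fun i j a ha => by
    simp only [LinearMap.mem_eqLocus, AlgHom.toLinearMap_apply, map_mul] at ha ⊢
    rw [ha, hfg]
  ext a
  have ha : a ∈ LinearMap.eqLocus f.toLinearMap g.toLinearMap := this ▸ Submodule.mem_top
  exact ha

/-- The automorphism and the derivation of the Ore extension by the entry at `p`. -/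
theorem exists_automorphism_derivation {p : Fin n × Fin n} (h : IsPresentedOn q (lexGT p) X)
    (hq : q ≠ 0) : ∃ (τ : A →ₐ[ℂ] A) (δ : A →ₗ[ℂ] A), Function.Injective τ ∧ δ 1 = 0 ∧
      (∀ a b, δ (a * b) = τ a * δ b + δ a * b) ∧
      (∀ k l, τ (X k l) = IsQMatrixOn.oreScalar q p k l • X k l) ∧
      ∀ k l, δ (X k l) = IsQMatrixOn.oreDelta q X p k l := by
  obtain ⟨τ, hτ⟩ := h.lift _ (h.rel.smul (IsQMatrixOn.oreScalar q p)
    fun i j k l hU hik hjl => IsQMatrixOn.oreScalar_mul_oreScalar hik hjl hU)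
  -- Inverse scalars define a left inverse of `τ`; it is only needed for injectivity.
  obtain ⟨τ', hτ'⟩ := h.lift _ (h.rel.smul (fun k l => (IsQMatrixOn.oreScalar q p k l)⁻¹)
    fun i j k l hU hik hjl => by
      rw [← mul_inv, IsQMatrixOn.oreScalar_mul_oreScalar hik hjl hU, mul_inv])
  obtain ⟨Θ, hΘ⟩ := h.lift _ (h.rel.oreMatrix_isQMatrixOn hq)
  have hne : ∀ k l, IsQMatrixOn.oreScalar q p k l ≠ 0 := by
    intro k l
    rw [IsQMatrixOn.oreScalar]
    split_ifs <;> simp [hq]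
  have hinv : τ'.comp τ = AlgHom.id ℂ A := h.hom_ext fun i j => by
    simp [hτ, hτ', hne]
  -- On every element `Θ` is upper triangular with diagonal (τ a, a), so its upper right entry is a
  -- τ-derivation.
  have key : ∀ a, Θ a 0 0 = τ a ∧ Θ a 1 0 = 0 ∧ Θ a 1 1 = a := by
    let P : Submodule ℂ A :=
      { carrier := {a | Θ a 0 0 = τ a ∧ Θ a 1 0 = 0 ∧ Θ a 1 1 = a}
        add_mem' := by
          rintro a b ⟨h1, h2, h3⟩ ⟨h1', h2', h3'⟩
          simp [h1, h2, h3, h1', h2', h3']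
        zero_mem' := by simp
        smul_mem' := by
          rintro c a ⟨h1, h2, h3⟩
          simp [h1, h2, h3] }
    have hP : P = ⊤ := by
      refine h.span P ⟨by simp, by simp, by simp⟩ ?_
      rintro i j a ⟨h1, h2, h3⟩
      refine ⟨?_, ?_, ?_⟩ <;>
      simp [hΘ, IsQMatrixOn.oreMatrix, Matrix.mul_apply, h1, h2, h3, hτ]
    intro a
    have ha : a ∈ P := hP ▸ Submodule.mem_top
    exact ha
  refine ⟨τ, { toFun := fun a => Θ a 0 1, map_add' := by simp, map_smul' := by simp },
    Function.LeftInverse.injective (g := τ') fun a => DFunLike.congr_fun hinv a, by simp,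
    fun a b => ?_, hτ, fun k l => ?_⟩
  · simp [Matrix.mul_apply, key]
  · simp [hΘ, IsQMatrixOn.oreMatrix]

theorem lexGT_or_eq_or_notMem (p : Fin n × Fin n) (k l : Fin n) :
    (k, l) ∈ lexGT p ∨ (k, l) = p ∨ (k, l) ∉ lexGE p := by
  simp only [lexGT, lexGE, Set.mem_ofPred_eq, Prod.ext_iff]
  grind

theorem lexGT_subset_lexGE (p : Fin n × Fin n) : lexGT p ⊆ lexGE p := fun _ h =>
  h.imp id fun h => ⟨h.1, h.2.le⟩

theorem notMem_lexGT_self (p : Fin n × Fin n) : p ∉ lexGT p := by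
  simp [lexGT]

theorem mem_lexGE_self (p : Fin n × Fin n) : p ∈ lexGE p := Or.inr ⟨rfl, le_rfl⟩

theorem mem_lexGT_of_mem_lexGE {p : Fin n × Fin n} {i j k l : Fin n} (h : (i, j) ∈ lexGE p)
    (hik : i < k) : (k, l) ∈ lexGT p :=
  Or.inl (h.elim (fun h => h.trans hik) fun h => h.1.le.trans_lt hik)

theorem mem_lexGT_of_mem_lexGE_row {p : Fin n × Fin n} {i j l : Fin n} (h : (i, j) ∈ lexGE p)
    (hjl : j < l) : (i, l) ∈ lexGT p :=
  h.imp id fun h => ⟨h.1, h.2.trans_lt hjl⟩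

open Classical in
/-- The entries after `p` of a quantum matrix satisfy the relations on `lexGT p`. -/
theorem _root_.QuantumMatrices.IsQMatrixOn.restrict {p : Fin n × Fin n}
    (h : IsQMatrixOn q (lexGE p) X) : IsQMatrixOn q (lexGT p)
      (fun k l => if (k, l) ∈ lexGT p then X k l else 0 : Matrix (Fin n) (Fin n) A) where
  diag i j k l hU hik hjl := by
    have hU' := lexGT_subset_lexGE p hU
    simp only [hU, mem_lexGT_of_mem_lexGE hU' hik, mem_lexGT_of_mem_lexGE_row hU' hjl, if_true,
      h.diag hU' hik hjl]
  row i j l hjl := by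
    split_ifs <;> simp [h.row hjl]
  col i j k hik := by
    split_ifs <;> simp [h.col hik]
  anti i j k l hik hlj := by
    split_ifs <;> simp [h.anti hik hlj]
  zero i j hU := if_neg hU

theorem exists_inclusion {p : Fin n × Fin n} {R : Type} [Ring R] [Algebra ℂ R]
    {Y : Matrix (Fin n) (Fin n) R} (hX : IsPresentedOn q (lexGE p) X)
    (hY : IsPresentedOn q (lexGT p) Y) :
    ∃ ι : R →ₐ[ℂ] A, ∀ k l, (k, l) ∈ lexGT p → ι (Y k l) = X k l := by
  obtain ⟨ι, hι⟩ := hY.lift _ hX.rel.restrict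
  exact ⟨ι, fun k l h => (hι k l).trans (if_pos h)⟩

section Representation

variable {R : Type} [Ring R] [Algebra ℂ R]

/-- Left multiplication by constants on the polynomial ring. -/
def mulLeftC (R : Type) [Ring R] [Algebra ℂ R] : R →ₐ[ℂ] Module.End ℂ R[X] :=
  (Algebra.lmul ℂ R[X]).comp Polynomial.CAlgHom

theorem mulLeftC_apply (r : R) (f : R[X]) : mulLeftC R r f = C r * f := rfl

theorem oreMulX_mul_mulLeftC {τ : R →ₐ[ℂ] R} {δ : R →ₗ[ℂ] R}
    (hδ : ∀ a b, δ (a * b) = τ a * δ b + δ a * b) (r : R) :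
    oreMulX τ δ * mulLeftC R r = mulLeftC R (τ r) * oreMulX τ δ + mulLeftC R (δ r) := by
  refine LinearMap.ext fun f => ?_
  simp only [Module.End.mul_apply, LinearMap.add_apply, mulLeftC_apply]
  induction f using Polynomial.induction_on' with
  | add f g hf hg => simp only [mul_add, map_add, hf, hg]; abel
  | monomial k s =>
    simp only [C_mul_monomial, oreMulX_monomial, mul_add, map_mul, hδ, map_add]
    abel

-- Entry `p` acts as the Ore variable and later entries act as constants. Relations involving `p`
-- are then the commutation rule x r = τ(r) x + δ(r), and the others hold already in `R`.
open Classical in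
theorem isQMatrixOn_representation {p : Fin n × Fin n} {Y : Matrix (Fin n) (Fin n) R}
    (hY : IsQMatrixOn q (lexGT p) Y) {τ : R →ₐ[ℂ] R} {δ : R →ₗ[ℂ] R}
    (hδ : ∀ a b, δ (a * b) = τ a * δ b + δ a * b)
    (hτY : ∀ k l, τ (Y k l) = IsQMatrixOn.oreScalar q p k l • Y k l)
    (hδY : ∀ k l, δ (Y k l) = IsQMatrixOn.oreDelta q Y p k l) :
    IsQMatrixOn q (lexGE p) (fun k l => if (k, l) = p then oreMulX τ δ else mulLeftC R (Y k l) :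
      Matrix (Fin n) (Fin n) (Module.End ℂ R[X])) := by
  have hne : ∀ {k l}, (k, l) ∈ lexGT p → (k, l) ≠ p := fun h h' =>
    notMem_lexGT_self p (h' ▸ h)
  have hT := fun k l => oreMulX_mul_mulLeftC hδ (Y k l)
  simp only [hτY, hδY, map_smul] at hT
  refine ⟨fun i j k l hU hik hjl => ?_, fun i j l hjl => ?_, fun i j k hik => ?_,
    fun i j k l hik hlj => ?_, fun i j hU => ?_⟩
  · have h1 : (k, l) ∈ lexGT p := mem_lexGT_of_mem_lexGE hU hik
    have h2 : (k, j) ∈ lexGT p := mem_lexGT_of_mem_lexGE hU hik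
    have h3 := mem_lexGT_of_mem_lexGE_row hU hjl
    simp only [hne h1, hne h2, hne h3, if_false]
    split_ifs with h
    · subst h
      rw [hT, IsQMatrixOn.oreScalar_of_lt hik hjl, IsQMatrixOn.oreDelta_of_lt hik hjl, one_smul,
        map_smul, map_mul]
    · have hU' : (i, j) ∈ lexGT p :=
        (lexGT_or_eq_or_notMem p i j).resolve_right fun h' => h'.elim h fun h' => h' hU
      rw [← map_mul, hY.diag hU' hik hjl]
      simp
  · split_ifs with h h' h'
    · simp [← h', hjl.ne] at h
    · subst h
      rw [hT, IsQMatrixOn.oreScalar_left, IsQMatrixOn.oreDelta_left, map_zero, add_zero,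
        smul_mul_assoc]
    · subst h'
      rw [hY.zero (i := i) (j := j) (by simp [lexGT, hjl.le])]
      simp
    · rw [← map_mul, hY.row hjl]
      simp
  · split_ifs with h h' h'
    · simp [← h', hik.ne] at h
    · subst h
      rw [hT]
      have := IsQMatrixOn.oreScalar_right (q := q) (p := (i, j)) (k := k)
      have h' := IsQMatrixOn.oreDelta_right (q := q) (X := Y) (p := (i, j)) (k := k)
      simp only at this h'
      rw [this, h', map_zero, add_zero, smul_mul_assoc]
    · subst h'
      rw [hY.zero (i := i) (j := j) (by simp [lexGT, hik.le, hik.ne'])]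
      simp
    · rw [← map_mul, hY.col hik]
      simp
  · split_ifs with h h' h'
    · simp [← h', hik.ne] at h
    · subst h
      rw [hT, IsQMatrixOn.oreScalar_of_gt hik hlj, IsQMatrixOn.oreDelta_of_gt hlj, one_smul,
        map_zero, add_zero]
    · subst h'
      rw [hY.zero (i := i) (j := j) (by simp [lexGT, hik.le, hik.ne'])]
      simp
    · rw [← map_mul, hY.anti hik hlj, map_mul]
  · rw [if_neg, hY.zero fun h => hU (lexGT_subset_lexGE p h), map_zero]
    rintro rfl
    exact hU (mem_lexGE_self _)

end Representation

/-- The commutation rule holds on generators and extends by the twisted Leibniz rule. Independence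
of the powers of x comes from the representation on R[X], so no basis of ordered monomials is
needed. -/
theorem isOreExtension {p : Fin n × Fin n} {R : Type} [Ring R] [Algebra ℂ R]
    {Y : Matrix (Fin n) (Fin n) R} (hX : IsPresentedOn q (lexGE p) X)
    (hY : IsPresentedOn q (lexGT p) Y) (hq : q ≠ 0) :
    ∃ (ι : R →ₐ[ℂ] A) (τ : R →ₐ[ℂ] R) (δ : R →ₗ[ℂ] R), Function.Injective τ ∧
      (∀ k l, (k, l) ∈ lexGT p → ι (Y k l) = X k l) ∧
      (∀ k l, τ (Y k l) = IsQMatrixOn.oreScalar q p k l • Y k l) ∧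
      IsOreExtension ι (X p.1 p.2) τ δ := by
  obtain ⟨τ, δ, hinj, hδ1, hδ, hτY, hδY⟩ := hY.exists_automorphism_derivation hq
  obtain ⟨ι, hι⟩ := hX.exists_inclusion hY
  obtain ⟨ρ, hρ⟩ := hX.lift _ (isQMatrixOn_representation hY.rel hδ hτY hδY)
  have hρι : ρ.comp ι = mulLeftC R := hY.hom_ext fun k l => by
    by_cases hkl : (k, l) ∈ lexGT p
    · rw [AlgHom.comp_apply, hι k l hkl, hρ, if_neg]
      rintro rfl
      exact notMem_lexGT_self _ hkl
    · simp [hY.rel.zero hkl]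
  have hbase : ∀ k l, X p.1 p.2 * ι (Y k l) =
      ι (τ (Y k l)) * X p.1 p.2 + ι (δ (Y k l)) := by
    intro k l
    rw [hτY, hδY]
    by_cases hkl : (k, l) ∈ lexGT p
    · rw [map_smul, hι k l hkl]
      obtain hk | ⟨rfl, hl⟩ : p.1 < k ∨ p.1 = k ∧ p.2 < l := hkl
      · rcases lt_trichotomy p.2 l with hl | rfl | hl
        · rw [IsQMatrixOn.oreScalar_of_lt hk hl, IsQMatrixOn.oreDelta_of_lt hk hl, one_smul,
            map_smul, map_mul, hι p.1 l (Or.inr ⟨rfl, hl⟩), hι k p.2 (Or.inl hk),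
            hX.rel.diag (mem_lexGE_self p) hk hl]
        · rw [IsQMatrixOn.oreScalar_right, IsQMatrixOn.oreDelta_right, map_zero, add_zero,
            smul_mul_assoc, hX.rel.col hk]
        · rw [IsQMatrixOn.oreScalar_of_gt hk hl, IsQMatrixOn.oreDelta_of_gt hl, one_smul, map_zero,
            add_zero, hX.rel.anti hk hl]
      · rw [IsQMatrixOn.oreScalar_left, IsQMatrixOn.oreDelta_left, map_zero, add_zero,
          smul_mul_assoc, hX.rel.row hl]
    · have : IsQMatrixOn.oreDelta q Y p k l = 0 := if_neg fun h => hkl (Or.inl h.1)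
      simp [hY.rel.zero hkl, this]
  have hcomm : ∀ r, X p.1 p.2 * ι r = ι (τ r) * X p.1 p.2 + ι (δ r) := by
    let P : Submodule ℂ R := LinearMap.eqLocus
      (LinearMap.mulLeft ℂ (X p.1 p.2) ∘ₗ ι.toLinearMap)
      (LinearMap.mulRight ℂ (X p.1 p.2) ∘ₗ ι.toLinearMap ∘ₗ τ.toLinearMap + ι.toLinearMap ∘ₗ δ)
    have hP : P = ⊤ := by
      refine hY.span P (by simp [P, hδ1]) fun i j a ha => ?_
      simp only [P, LinearMap.mem_eqLocus, LinearMap.comp_apply, LinearMap.add_apply,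
        LinearMap.mulLeft_apply, LinearMap.mulRight_apply, AlgHom.toLinearMap_apply] at ha ⊢
      rw [map_mul, ← mul_assoc, hbase, add_mul, mul_assoc, ha, hδ]
      simp only [map_mul, map_add, mul_add, mul_assoc, add_assoc]
    intro r
    have hr : r ∈ P := hP ▸ Submodule.mem_top
    exact hr
  refine ⟨ι, τ, δ, hinj, hι, hτY, IsOreExtension.of_representation hcomm hδ1 ?_ ρ ?_ ?_⟩
  · intro P h1 hx hR
    refine hX.span P h1 fun i j a ha => ?_
    rcases lexGT_or_eq_or_notMem p i j with h | rfl | h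
    · rw [← hι i j h]
      exact hR _ a ha
    · exact hx a ha
    · rw [hX.rel.zero h, zero_mul]
      exact P.zero_mem
  · rw [hρ, if_pos rfl]
  · intro r f
    rw [← mulLeftC_apply, ← hρι, AlgHom.comp_apply]

/-- All generators vanish, so every element is a scalar, and a homomorphism to ℂ shows that no
scalar collapses. -/
theorem noZeroDivisors_of_empty (hX : IsPresentedOn q ∅ X) : NoZeroDivisors A := by
  obtain ⟨f, -⟩ := hX.lift (B := ℂ) 0 ⟨by simp, by simp, by simp, by simp, by simp⟩
  have hP := hX.span (1 : Submodule ℂ A) (Submodule.one_le.1 le_rfl) fun i j a _ => by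
    rw [hX.rel.zero (Set.notMem_empty _), zero_mul]
    exact Submodule.zero_mem _
  have hA : ∀ a, ∃ c, algebraMap ℂ A c = a := fun a => by
    have ha : a ∈ (1 : Submodule ℂ A) := hP ▸ Submodule.mem_top
    simpa [Submodule.mem_one] using ha
  refine ⟨fun {a b} hab => ?_⟩
  obtain ⟨c, rfl⟩ := hA a
  obtain ⟨d, rfl⟩ := hA b
  have := congrArg f hab
  rw [map_mul, map_zero, AlgHom.commutes, AlgHom.commutes] at this
  rcases mul_eq_zero.1 this with h | h
  · left
    rw [show c = 0 from h, map_zero]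
  · right
    rw [show d = 0 from h, map_zero]

/-- Entries are adjoined one at a time, from the last position backwards, each step being an Ore
extension with injective twist. -/
theorem noZeroDivisors_lexGE (hq : q ≠ 0) (p : Fin n ×ₗ Fin n) :
    ∀ {A : Type} [Ring A] [Algebra ℂ A] {X : Matrix (Fin n) (Fin n) A},
      IsPresentedOn q (lexGE (ofLex p)) X → NoZeroDivisors A := by
  induction p using WellFoundedGT.induction with
  | ind p ih =>
  intro A _ _ X hX
  obtain ⟨R, _, _, Y, hY⟩ := exists_isPresentedOn n q (lexGT (ofLex p))
  have hR : NoZeroDivisors R := by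
    have hlt : ∀ r : Fin n × Fin n, r ∈ lexGT (ofLex p) ↔ p < toLex r := fun r => by
      rw [Prod.Lex.lt_iff]
      rfl
    have hle : ∀ r s : Fin n × Fin n, r ∈ lexGE s ↔ toLex s ≤ toLex r := fun r s => by
      rw [Prod.Lex.le_iff]
      rfl
    -- Either `p` is the last position, or the positions after `p` are those from its immediate
    -- successor on.
    rcases (lexGT (ofLex p)).eq_empty_or_nonempty with h | h
    · rw [h] at hY
      exact hY.noZeroDivisors_of_empty
    · obtain ⟨s, hs, hmin⟩ := Set.exists_min_image _ toLex (Set.toFinite _) h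
      have : lexGT (ofLex p) = lexGE s := by
        ext r
        rw [hle]
        exact ⟨hmin r, fun h => (hlt r).2 (((hlt s).1 hs).trans_le h)⟩
      rw [this] at hY
      exact ih (toLex s) ((hlt s).1 hs) hY
  obtain ⟨ι, τ, δ, hτ, -, -, h⟩ := hX.isOreExtension hY hq
  exact h.noZeroDivisors hτ

end IsPresentedOn

theorem OqM.noZeroDivisors (n : ℕ) {q : ℂ} (hq : q ≠ 0) : NoZeroDivisors (OqM n q) := by
  have h := isPresentedOn_genX n q
  cases n with
  | zero =>
    rw [Set.eq_empty_of_isEmpty Set.univ] at h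
    exact h.noZeroDivisors_of_empty
  | succ n =>
    have : (Set.univ : Set (Fin (n + 1) × Fin (n + 1))) = lexGE (0, 0) := by
      ext r
      simp only [Set.mem_univ, lexGE, Set.mem_ofPred_eq, Fin.zero_le, and_true, true_iff]
      exact (Fin.zero_le r.1).lt_or_eq
    rw [this] at h
    exact IsPresentedOn.noZeroDivisors_lexGE hq (toLex (0, 0)) h

/-! ### Restriction to the torus is injective on the centralizer of σ₁ -/

theorem permLength_one (t : ℕ) : permLength (1 : Equiv.Perm (Fin t)) = 0 := by
  rw [permLength, Finset.card_eq_zero, Finset.filter_eq_empty_iff]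
  exact fun p _ h => lt_asymm h.1 h.2

theorem sigmaM_one (n : ℕ) (q : ℂ) : sigmaM n q 1 = ∑ i, genX n q i i := by
  rw [sigmaM, qSigma]
  symm
  refine Fintype.sum_bijective (fun i => ⟨{i}, Finset.card_singleton i⟩) ⟨fun i j h => ?_, ?_⟩ _ _
    fun i => ?_
  · simpa using h
  · rintro ⟨I, hI⟩
    obtain ⟨i, rfl⟩ := Finset.card_eq_one.1 hI
    exact ⟨i, rfl⟩
  · simp [qMinor, qDet, Subsingleton.elim _ (1 : Equiv.Perm (Fin 1)), permLength_one]

/-- The correction term in `diag` vanishes: both factors nonzero would force i < k = j < l = i. -/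
theorem isQMatrix_diagonal (q : ℂ) {n : ℕ} {A : Type*} [CommRing A] [Algebra ℂ A]
    (t : Fin n → A) : IsQMatrix q (Matrix.diagonal t) where
  diag i j k l hik hjl := by
    have : Matrix.diagonal t i l * Matrix.diagonal t k j = 0 := by
      by_cases h : i = l
      · rw [Matrix.diagonal_apply_ne t (i := k) (j := j), mul_zero]
        rintro rfl
        exact (hik.trans hjl).ne h
      · rw [Matrix.diagonal_apply_ne t h, zero_mul]
    rw [this, smul_zero, add_zero, mul_comm]
  row i j l hjl := by
    simp only [Matrix.diagonal_apply]
    split_ifs with h h' <;> simp_all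
  col i j k hik := by
    simp only [Matrix.diagonal_apply]
    split_ifs with h h' <;> simp_all
  anti i j k l _ _ := mul_comm _ _

/-- Restriction of functions to the diagonal torus. -/
def diagHom (n : ℕ) (q : ℂ) : OqM n q →ₐ[ℂ] MvPolynomial (Fin n) ℂ :=
  OqM.lift (Matrix.diagonal MvPolynomial.X) (isQMatrix_diagonal q _)

theorem diagHom_genX (n : ℕ) (q : ℂ) (i j : Fin n) :
    diagHom n q (genX n q i j) = Matrix.diagonal MvPolynomial.X i j :=
  OqM.lift_genX _ _ i j

/-- The block diagonal matrix with blocks `t` and `Y`. -/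
def blockDiag {n : ℕ} {A : Type*} [Ring A] (t : A) (Y : Matrix (Fin n) (Fin n) A) :
    Matrix (Fin (n + 1)) (Fin (n + 1)) A :=
  fun i j => Fin.cases (Fin.cases t (fun _ => 0) j) (fun i' => Fin.cases 0 (fun j' => Y i' j') j) i

section BlockDiag

variable {n : ℕ} {A : Type*} [Ring A] (t : A) (Y : Matrix (Fin n) (Fin n) A)

@[simp] theorem blockDiag_zero_zero : blockDiag t Y 0 0 = t := rfl

@[simp] theorem blockDiag_zero_succ (j : Fin n) : blockDiag t Y 0 j.succ = 0 := rfl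

@[simp] theorem blockDiag_succ_zero (i : Fin n) : blockDiag t Y i.succ 0 = 0 := rfl

@[simp] theorem blockDiag_succ_succ (i j : Fin n) : blockDiag t Y i.succ j.succ = Y i j := rfl

end BlockDiag

theorem IsQMatrix.blockDiag {q : ℂ} {n : ℕ} {A : Type*} [Ring A] [Algebra ℂ A] {t : A}
    {Y : Matrix (Fin n) (Fin n) A} (hY : IsQMatrix q Y) (ht : ∀ i j, Commute t (Y i j)) :
    IsQMatrix q (blockDiag t Y) where
  diag i j k l hik hjl := by
    obtain ⟨k, rfl⟩ := Fin.exists_succ_eq.2 (Fin.ne_zero_of_lt hik)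
    obtain ⟨l, rfl⟩ := Fin.exists_succ_eq.2 (Fin.ne_zero_of_lt hjl)
    cases i using Fin.cases <;> cases j using Fin.cases
    · simp [(ht k l).eq]
    · simp
    · simp
    · simpa using hY.diag (Fin.succ_lt_succ_iff.1 hik) (Fin.succ_lt_succ_iff.1 hjl)
  row i j l hjl := by
    obtain ⟨l, rfl⟩ := Fin.exists_succ_eq.2 (Fin.ne_zero_of_lt hjl)
    cases i using Fin.cases <;> cases j using Fin.cases
    · simp
    · simp
    · simp
    · simpa using hY.row (Fin.succ_lt_succ_iff.1 hjl)
  col i j k hik := by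
    obtain ⟨k, rfl⟩ := Fin.exists_succ_eq.2 (Fin.ne_zero_of_lt hik)
    cases i using Fin.cases <;> cases j using Fin.cases
    · simp
    · simp
    · simp
    · simpa using hY.col (Fin.succ_lt_succ_iff.1 hik)
  anti i j k l hik hlj := by
    obtain ⟨k, rfl⟩ := Fin.exists_succ_eq.2 (Fin.ne_zero_of_lt hik)
    obtain ⟨j, rfl⟩ := Fin.exists_succ_eq.2 (Fin.ne_zero_of_lt hlj)
    cases i using Fin.cases <;> cases l using Fin.cases
    · simp
    · simp
    · simp
    · simpa using hY.anti (Fin.succ_lt_succ_iff.1 hik) (Fin.succ_lt_succ_iff.1 hlj)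

/-- Restriction of functions to block diagonal matrices with blocks of sizes `1` and `n`. -/
def blockHom (n : ℕ) (q : ℂ) : OqM (n + 1) q →ₐ[ℂ] (OqM n q)[X] :=
  OqM.lift (blockDiag X ((genX n q).map C)) <| by
    have h := isQMatrix_genX n q
    refine IsQMatrix.blockDiag ⟨fun i j k l hik hjl => ?_, fun i j l hjl => ?_,
      fun i j k hik => ?_, fun i j k l hik hlj => ?_⟩ fun i j => commute_X _
    · simp only [Matrix.map_apply, ← C_mul, h.diag hik hjl, C_add, smul_C]
    · simp only [Matrix.map_apply, ← C_mul, h.row hjl, smul_C]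
    · simp only [Matrix.map_apply, ← C_mul, h.col hik, smul_C]
    · simp only [Matrix.map_apply, ← C_mul, h.anti hik hlj]

theorem blockHom_genX (n : ℕ) (q : ℂ) (i j : Fin (n + 1)) :
    blockHom n q (genX (n + 1) q i j) = blockDiag X ((genX n q).map C) i j :=
  OqM.lift_genX _ _ i j

theorem blockHom_sigmaM_one (n : ℕ) (q : ℂ) :
    blockHom n q (sigmaM (n + 1) q 1) = X + C (sigmaM n q 1) := by
  simp [sigmaM_one, Fin.sum_univ_succ, blockHom_genX]

/-- The torus lies in the block diagonal matrices, so restriction can be computed coefficientwise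
after restricting to the blocks. This feeds the induction on the size. -/
theorem finSuccEquiv_diagHom (n : ℕ) (q : ℂ) (a : OqM (n + 1) q) :
    MvPolynomial.finSuccEquiv ℂ n (diagHom (n + 1) q a) =
      Polynomial.map (diagHom n q : OqM n q →+* MvPolynomial (Fin n) ℂ) (blockHom n q a) := by
  have : ((MvPolynomial.finSuccEquiv ℂ n).toAlgHom.comp (diagHom (n + 1) q)) =
      (Polynomial.mapAlgHom (diagHom n q)).comp (blockHom n q) := by
    refine (isPresentedOn_genX (n + 1) q).hom_ext fun i j => ?_
    cases i using Fin.cases <;> cases j using Fin.cases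
    · simp [diagHom_genX, blockHom_genX, MvPolynomial.finSuccEquiv_X_zero]
    · simp [diagHom_genX, blockHom_genX, (Fin.succ_ne_zero _).symm]
    · simp [diagHom_genX, blockHom_genX]
    · rename_i i j
      by_cases h : i = j
      · subst h
        simp [diagHom_genX, blockHom_genX, MvPolynomial.finSuccEquiv_X_succ]
      · simp [diagHom_genX, blockHom_genX, h]
  exact DFunLike.congr_fun this a

/-- The elements fixed by the automorphism of the Ore extension by the corner entry come from the
smaller quantum matrices. -/
theorem exists_eq_of_fixed {n : ℕ} {q : ℂ} (hq : ∀ m : ℕ, 0 < m → q ^ m ≠ 1)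
    {R : Type} [Ring R] [Algebra ℂ R] {Y : Matrix (Fin (n + 1)) (Fin (n + 1)) R}
    (hY : IsPresentedOn q (lexGT (0, 0)) Y) {τ : R →ₐ[ℂ] R}
    (hτ : ∀ k l, τ (Y k l) = IsQMatrixOn.oreScalar q (0, 0) k l • Y k l)
    {e : OqM n q →ₐ[ℂ] R} (he : ∀ i j, e (genX n q i j) = Y i.succ j.succ) {b : R}
    (hb : τ b = b) : ∃ c, e c = b := by
  have hτe : ∀ c, τ (e c) = e c := by
    have : τ.comp e = e := (isPresentedOn_genX n q).hom_ext fun i j => by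
      simp [he, hτ, IsQMatrixOn.oreScalar, Fin.succ_ne_zero]
    exact DFunLike.congr_fun this
  let E : ℂ → Submodule ℂ R := Module.End.eigenspace τ.toLinearMap
  -- `V` collects the words that contain an entry of the first row or column: each such entry
  -- contributes one factor q to the eigenvalue of `τ`.
  let V : Submodule ℂ R := ⨆ d : ℕ, E (q ^ (d + 1))
  have hE : ∀ {μ : ℂ} {a : R}, a ∈ E μ ↔ τ a = μ • a := fun {μ a} => by
    rw [Module.End.mem_eigenspace_iff]
    rfl
  have hVmul : ∀ (y : R) (k : ℕ), τ y = q ^ k • y → ∀ a ∈ V, y * a ∈ V := by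
    intro y k hy
    have : V.map (LinearMap.mulLeft ℂ y) ≤ V := by
      rw [Submodule.map_iSup]
      refine iSup_le fun d => ?_
      rintro _ ⟨a, ha, rfl⟩
      refine Submodule.mem_iSup_of_mem (d + k) (hE.2 ?_)
      rw [LinearMap.mulLeft_apply, map_mul, hy, hE.1 ha, smul_mul_smul_comm, ← pow_add]
      congr 2
      omega
    exact fun a ha => this ⟨a, ha, rfl⟩
  have hP : LinearMap.range e.toLinearMap ⊔ V = ⊤ := by
    refine hY.span _ (Submodule.mem_sup_left ⟨1, map_one e⟩) fun i j a ha => ?_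
    obtain ⟨_, ⟨c, rfl⟩, v, hv, rfl⟩ := Submodule.mem_sup.1 ha
    rw [mul_add]
    by_cases h : i = 0 ∨ j = 0
    · have h1 : τ (Y i j) = q • Y i j := by rw [hτ, IsQMatrixOn.oreScalar, if_pos h]
      refine Submodule.mem_sup_right (Submodule.add_mem _ ?_ (hVmul _ 1 (by simpa using h1) v hv))
      refine Submodule.mem_iSup_of_mem 0 (hE.2 ?_)
      rw [AlgHom.toLinearMap_apply, map_mul, hτe, h1, zero_add, pow_one, smul_mul_assoc]
    · have h1 : τ (Y i j) = q ^ 0 • Y i j := by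
        rw [hτ, IsQMatrixOn.oreScalar, if_neg h, pow_zero]
      rw [not_or] at h
      refine Submodule.add_mem _ (Submodule.mem_sup_left ?_)
        (Submodule.mem_sup_right (hVmul _ 0 h1 v hv))
      obtain ⟨i, rfl⟩ := Fin.exists_succ_eq.2 h.1
      obtain ⟨j, rfl⟩ := Fin.exists_succ_eq.2 h.2
      exact ⟨genX n q i j * c, by simp [he]⟩
  obtain ⟨_, ⟨c, rfl⟩, v, hv, rfl⟩ := Submodule.mem_sup.1 (hP ▸ Submodule.mem_top : b ∈ _)
  -- As no positive power of q equals 1, the eigenspace of 1 meets `V` only in 0.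
  have hdisj := (Module.End.eigenspaces_iSupIndep τ.toLinearMap) 1
  have hv1 : v ∈ E 1 := by
    rw [hE, one_smul]
    rw [map_add, AlgHom.toLinearMap_apply, hτe] at hb
    exact add_left_cancel hb
  have hv2 : v ∈ ⨆ (μ : ℂ) (_ : μ ≠ 1), E μ := by
    refine (iSup_le fun d => ?_ : V ≤ _) hv
    exact le_iSup₂_of_le (q ^ (d + 1)) (hq _ d.succ_pos) le_rfl
  have hv0 : v = 0 := by simpa using (Submodule.disjoint_def.1 hdisj) v hv1 hv2
  exact ⟨c, by rw [hv0, add_zero]; rfl⟩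

/-- By induction on the size, it suffices that the leading coefficient in x_{11} vanishes.
Commutation with σ₁ makes it fixed by τ, hence an element of the smaller algebra; block restriction
shows that it inherits both hypotheses. -/
theorem eq_zero_of_diagHom_eq_zero {n : ℕ} {q : ℂ} (hq0 : q ≠ 0)
    (hq : ∀ m : ℕ, 0 < m → q ^ m ≠ 1) {a : OqM n q} (ha : Commute a (sigmaM n q 1))
    (hD : diagHom n q a = 0) : a = 0 := by
  induction n with
  | zero =>
    obtain ⟨c, rfl⟩ : ∃ c, algebraMap ℂ (OqM 0 q) c = a := by
      clear ha hD
      induction a using OqM.induction with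
      | one => exact ⟨1, map_one _⟩
      | smul c a ih =>
        obtain ⟨d, rfl⟩ := ih
        exact ⟨c * d, by rw [map_mul, ← Algebra.smul_def]⟩
      | add a b iha ihb =>
        obtain ⟨c, rfl⟩ := iha
        obtain ⟨d, rfl⟩ := ihb
        exact ⟨c + d, map_add _ _ _⟩
      | mul i => exact i.elim0
    rw [AlgHom.commutes] at hD
    rw [(map_eq_zero _).1 hD, map_zero]
  | succ n ih =>
    have huniv : (Set.univ : Set (Fin (n + 1) × Fin (n + 1))) = lexGE (0, 0) := by
      ext r
      simp only [Set.mem_univ, lexGE, Set.mem_ofPred_eq, Fin.zero_le, and_true, true_iff]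
      exact (Fin.zero_le r.1).lt_or_eq
    have hX := isPresentedOn_genX (n + 1) q
    rw [huniv] at hX
    obtain ⟨R, _, _, Y, hY⟩ := exists_isPresentedOn (n + 1) q (lexGT (0, 0))
    obtain ⟨ι, τ, δ, -, hι, hτ, hO⟩ := hX.isOreExtension hY hq0
    have hGT : ∀ i j : Fin n, (i.succ, j.succ) ∈ lexGT ((0 : Fin (n + 1)), (0 : Fin (n + 1))) :=
      fun i j => Or.inl i.succ_pos
    let e : OqM n q →ₐ[ℂ] R := OqM.lift (Y.submatrix Fin.succ Fin.succ)
      ⟨fun i j k l hik hjl => hY.rel.diag (hGT i j) (Fin.succ_lt_succ_iff.2 hik)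
        (Fin.succ_lt_succ_iff.2 hjl), fun i j l hjl => hY.rel.row (Fin.succ_lt_succ_iff.2 hjl),
        fun i j k hik => hY.rel.col (Fin.succ_lt_succ_iff.2 hik),
        fun i j k l hik hlj => hY.rel.anti (Fin.succ_lt_succ_iff.2 hik)
          (Fin.succ_lt_succ_iff.2 hlj)⟩
    have he : ∀ i j, e (genX n q i j) = Y i.succ j.succ := OqM.lift_genX _ _
    -- Killing the first row and column yields a retraction `r` of `e`; the block is 0 because `R`
    -- lacks the corner entry.
    have hB := (isQMatrix_genX n q).blockDiag (t := 0) fun i j => Commute.zero_left _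
    obtain ⟨r, hr⟩ := hY.lift (blockDiag 0 (genX n q)) ⟨fun i j k l _ hik hjl => hB.diag hik hjl,
      hB.row, hB.col, hB.anti, fun i j h => by
        cases i using Fin.cases
        · cases j using Fin.cases
          · rfl
          · rfl
        · exact (h (Or.inl (Fin.succ_pos _))).elim⟩
    have hre : ∀ c, r (e c) = c := by
      have : r.comp e = AlgHom.id ℂ _ := (isPresentedOn_genX n q).hom_ext fun i j => by
        simp [he, hr]
      exact DFunLike.congr_fun this
    have hπι : ∀ s, blockHom n q (ι s) = C (r s) := by
      have : (blockHom n q).comp ι = Polynomial.CAlgHom.comp r := hY.hom_ext fun k l => by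
        by_cases hkl : (k, l) ∈ lexGT ((0 : Fin (n + 1)), (0 : Fin (n + 1)))
        · rw [AlgHom.comp_apply, hι k l hkl, blockHom_genX, AlgHom.comp_apply, hr]
          cases k using Fin.cases <;> cases l using Fin.cases
          · exact (IsPresentedOn.notMem_lexGT_self _ hkl).elim
          all_goals simp
        · simp [hY.rel.zero hkl]
      exact DFunLike.congr_fun this
    obtain ⟨f, rfl⟩ := hO.bijective.2 a
    simp only at ha hD ⊢
    have hπ : blockHom n q (f.eval₂ (ι : R →+* OqM (n + 1) q) (genX (n + 1) q 0 0)) =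
        f.map (r : R →+* OqM n q) := by
      clear ha hD
      induction f using Polynomial.induction_on' with
      | add f g hf hg => rw [eval₂_add, map_add, hf, hg, Polynomial.map_add]
      | monomial k s =>
        rw [eval₂_monomial, map_mul, map_pow, blockHom_genX, AlgHom.coe_toRingHom, hπι]
        simp [C_mul_X_pow_eq_monomial]
    -- the leading coefficient is fixed by `τ`
    have hfix : τ f.leadingCoeff = f.leadingCoeff := by
      obtain ⟨s, hs⟩ : ∃ s, sigmaM (n + 1) q 1 = genX (n + 1) q 0 0 + ι s := by
        refine ⟨∑ i : Fin n, Y i.succ i.succ, ?_⟩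
        rw [sigmaM_one, Fin.sum_univ_succ, map_sum]
        congr 1
        exact Finset.sum_congr rfl fun i _ => (hι _ _ (hGT i i)).symm
      -- This is commutation with σ₁ = x_{11} + s written on polynomials. One degree above that of
      -- `f` both terms with `s` vanish, which leaves the leading coefficient and its image under
      -- `τ`.
      have h1 : f * X + oreMul τ δ f (C s) = oreMulX τ δ f + C s * f := by
        refine hO.bijective.1 ?_
        have h2 := ha.eq
        rw [hs, mul_add, add_mul] at h2
        simp only [eval₂_add, eval₂_mul_X]
        rw [← IsOreExtension.eval₂_mul hO.comm, ← IsOreExtension.mul_eval₂ hO.comm,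
          ← IsOreExtension.algebraMap_mul_eval₂]
        simpa using h2
      have h3 := congrArg (fun g => g.coeff (f.natDegree + 1)) h1
      have h4 := natDegree_oreMul_le τ δ f (C s)
      rw [natDegree_C, add_zero] at h4
      simp only [coeff_add, coeff_mul_X, coeff_oreMulX_succ, coeff_C_mul] at h3
      rw [coeff_eq_zero_of_natDegree_lt (Nat.lt_succ_of_le h4),
        coeff_eq_zero_of_natDegree_lt (Nat.lt_succ_self f.natDegree)] at h3
      simpa using h3.symm
    obtain ⟨c, hc⟩ := exists_eq_of_fixed hq hY hτ he hfix
    have hcoeff : (f.map (r : R →+* OqM n q)).coeff f.natDegree = c := by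
      rw [coeff_map, AlgHom.coe_toRingHom, coeff_natDegree, ← hc, hre]
    have hcomm : Commute c (sigmaM n q 1) := by
      have h1 := ha.map (blockHom n q)
      rw [hπ, blockHom_sigmaM_one] at h1
      -- The block restriction of σ₁ is X plus the smaller σ₁, and X is central.
      have h2 : Commute (f.map (r : R →+* OqM n q)) (C (sigmaM n q 1)) := by
        simpa using h1.sub_right (commute_X _).symm
      have h3 := congrArg (fun g => g.coeff f.natDegree) h2.eq
      simp only [coeff_mul_C, coeff_C_mul, hcoeff] at h3
      exact h3
    have hDc : diagHom n q c = 0 := by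
      have h1 := finSuccEquiv_diagHom n q
        (f.eval₂ (ι : R →+* OqM (n + 1) q) (genX (n + 1) q 0 0))
      rw [hD, map_zero, hπ] at h1
      have h2 := congrArg (fun g => g.coeff f.natDegree) h1
      simp only [coeff_zero] at h2
      rw [coeff_map, hcoeff] at h2
      exact h2.symm
    have hf : f = 0 := by
      rw [← leadingCoeff_eq_zero, ← hc, ih hcomm hDc, map_zero]
    rw [hf, eval₂_zero]

/-! ### Symmetric polynomials and the criterion for statement (1) -/

section DiagonalRestriction

theorem qDet_diagonal (q : ℂ) {t : ℕ} {A : Type*} [CommRing A] [Algebra ℂ A] (d : Fin t → A) :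
    qDet q (Matrix.diagonal d) = ∏ i, d i := by
  rw [qDet, Finset.sum_eq_single 1]
  · simp [permLength_one, List.prod_ofFn]
  · intro s _ hs
    obtain ⟨a, ha⟩ : ∃ a, s a ≠ a := by
      by_contra! h
      exact hs (Equiv.ext h)
    rw [List.prod_ofFn, Finset.prod_eq_zero (Finset.mem_univ a), smul_zero]
    exact Matrix.diagonal_apply_ne d ha.symm
  · simp

theorem diagHom_sigmaM (n : ℕ) (q : ℂ) (t : ℕ) :
    diagHom n q (sigmaM n q t) = MvPolynomial.esymm (Fin n) ℂ t := by
  rw [sigmaM, qSigma, map_sum, MvPolynomial.esymm_eq_sum_subtype]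
  refine Finset.sum_congr rfl fun I _ => ?_
  rw [qMinor, map_qDet]
  have : (fun i j => diagHom n q ((genX n q).submatrix (I.1.orderEmbOfFin I.2)
      (I.1.orderEmbOfFin I.2) i j)) =
      Matrix.diagonal fun i => MvPolynomial.X (R := ℂ) (I.1.orderEmbOfFin I.2 i) := by
    ext1 i
    ext1 j
    rw [Matrix.submatrix_apply, diagHom_genX]
    simp [Matrix.diagonal_apply]
  rw [this, qDet_diagonal]
  conv_rhs => rw [← Finset.map_orderEmbOfFin_univ I.1 I.2, Finset.prod_map]
  rfl

theorem diagHom_detM_ne_zero (n : ℕ) (q : ℂ) : diagHom n q (detM n q) ≠ 0 := by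
  have h : (fun i j => diagHom n q (genX n q i j)) = Matrix.diagonal MvPolynomial.X := by
    ext1 i
    ext1 j
    exact diagHom_genX n q i j
  rw [detM, map_qDet, h, qDet_diagonal]
  exact Finset.prod_ne_zero_iff.2 fun i _ => MvPolynomial.X_ne_zero i

/-- The subalgebra generated by the sums of principal quantum minors. -/
def sigmaAlg (n : ℕ) (q : ℂ) : Subalgebra ℂ (OqM n q) :=
  Algebra.adjoin ℂ {y | ∃ i, 1 ≤ i ∧ i ≤ n ∧ y = sigmaM n q i}

theorem sigmaM_mem_sigmaAlg {n : ℕ} (q : ℂ) {i : ℕ} (h1 : 1 ≤ i) (hn : i ≤ n) :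
    sigmaM n q i ∈ sigmaAlg n q :=
  Algebra.subset_adjoin ⟨i, h1, hn, rfl⟩

theorem isSymmetric_diagHom {n : ℕ} {q : ℂ} {a : OqM n q} (ha : a ∈ sigmaAlg n q) :
    (diagHom n q a).IsSymmetric := by
  have h : sigmaAlg n q ≤ (MvPolynomial.symmetricSubalgebra (Fin n) ℂ).comap (diagHom n q) := by
    refine Algebra.adjoin_le ?_
    rintro _ ⟨i, -, -, rfl⟩
    change (diagHom n q (sigmaM n q i)).IsSymmetric
    rw [diagHom_sigmaM]
    exact MvPolynomial.esymm_isSymmetric _ _ _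
  exact h ha

/-- By the fundamental theorem of symmetric polynomials the e_i generate, and each e_i lifts to σ_i.
Commutativity of the σ_i plays no role. -/
theorem exists_mem_sigmaAlg {n : ℕ} (q : ℂ) {f : MvPolynomial (Fin n) ℂ} (hf : f.IsSymmetric) :
    ∃ a ∈ sigmaAlg n q, diagHom n q a = f := by
  obtain ⟨p, hp⟩ := MvPolynomial.esymmAlgHom_fin_surjective (n := n) (m := n) ℂ le_rfl ⟨f, hf⟩
  have hf' : MvPolynomial.aeval (fun i : Fin n => MvPolynomial.esymm (Fin n) ℂ (i + 1)) p = f := by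
    rw [← MvPolynomial.esymmAlgHom_apply, hp]
  rw [← hf']
  change _ ∈ (sigmaAlg n q).map (diagHom n q)
  have h : (MvPolynomial.aeval fun i : Fin n => MvPolynomial.esymm (Fin n) ℂ (i + 1)).range ≤
      (sigmaAlg n q).map (diagHom n q) := by
    rw [← Algebra.adjoin_range_eq_range_aeval]
    refine Algebra.adjoin_le ?_
    rintro _ ⟨i, rfl⟩
    exact ⟨sigmaM n q (i + 1), sigmaM_mem_sigmaAlg q (by omega) i.2, diagHom_sigmaM n q _⟩
  exact h ⟨p, rfl⟩

/-- An element of the centralizer of `σ₁` lies in the subalgebra of the `σ_i` if its restriction to the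
torus is symmetric. -/
theorem mem_sigmaAlg_of_isSymmetric {n : ℕ} {q : ℂ} (hq0 : q ≠ 0)
    (hq : ∀ m : ℕ, 0 < m → q ^ m ≠ 1)
    (hσ : ∀ i, 1 ≤ i → i ≤ n → Commute (sigmaM n q i) (sigmaM n q 1)) {a : OqM n q}
    (ha : Commute a (sigmaM n q 1)) (hD : (diagHom n q a).IsSymmetric) : a ∈ sigmaAlg n q := by
  obtain ⟨s, hs, hsa⟩ := exists_mem_sigmaAlg q hD
  have hs1 : Commute s (sigmaM n q 1) := by
    have h : sigmaAlg n q ≤ Subalgebra.centralizer ℂ {sigmaM n q 1} := by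
      refine Algebra.adjoin_le ?_
      rintro _ ⟨i, h1, hn, rfl⟩ _ rfl
      exact (hσ i h1 hn).symm
    exact (h hs _ rfl).symm
  -- Both elements lie in the centralizer of σ₁ and have the same restriction.
  have : a - s = 0 := eq_zero_of_diagHom_eq_zero hq0 hq (ha.sub_left hs1)
    (by rw [map_sub, hsa, sub_self])
  rw [sub_eq_zero.1 this]
  exact hs

/-- Replaces membership in a generated subalgebra by two conditions that can be checked after
passing to O_q(GL_n) or O_q(SL_n). -/
theorem centralizer_eq_sigmaAlg_iff {n : ℕ} {q : ℂ} (hq0 : q ≠ 0)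
    (hq : ∀ m : ℕ, 0 < m → q ^ m ≠ 1) :
    Subalgebra.centralizer ℂ {sigmaM n q 1} = sigmaAlg n q ↔
      (∀ i, 1 ≤ i → i ≤ n → Commute (sigmaM n q i) (sigmaM n q 1)) ∧
        ∀ a, Commute a (sigmaM n q 1) → (diagHom n q a).IsSymmetric := by
  constructor
  · intro h
    refine ⟨fun i h1 hn => ?_, fun a ha => isSymmetric_diagHom ?_⟩
    · have := sigmaM_mem_sigmaAlg q h1 hn
      rw [← h] at this
      exact (this _ rfl).symm
    · rw [← h]
      rintro _ rfl
      exact ha.eq.symm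
  · rintro ⟨hσ, hD⟩
    refine le_antisymm (fun a ha => ?_) (Algebra.adjoin_le ?_)
    · have ha' : Commute a (sigmaM n q 1) := (ha _ rfl).symm
      exact mem_sigmaAlg_of_isSymmetric hq0 hq hσ ha' (hD a ha')
    · rintro _ ⟨i, h1, hn, rfl⟩ _ rfl
      exact (hσ i h1 hn).symm

end DiagonalRestriction

theorem detM_ne_zero (n : ℕ) (q : ℂ) : detM n q ≠ 0 := fun h =>
  diagHom_detM_ne_zero n q (by rw [h, map_zero])

/-! ### Comparison with O_q(GL_n) -/

section GeneralLinear

/-- The powers of a central nonzero element of a domain form an Ore set of nonzerodivisors. The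
injective map to that Ore localization factors through `toGL` by the universal property. -/
theorem toGL_injective (n : ℕ) {q : ℂ} (hq : q ≠ 0) : Function.Injective (toGL n q) := by
  have hdom := OqM.noZeroDivisors n hq
  let S := Submonoid.powers (detM n q)
  have hcomm : ∀ (s : S) (a : OqM n q), (s : OqM n q) * a = a * s := by
    rintro ⟨_, k, rfl⟩ a
    exact ((commute_detM hq a).pow_left k).eq
  let _ : OreLocalization.OreSet S :=
    { ore_right_cancel := fun r₁ r₂ s h => ⟨s, by rw [hcomm, hcomm, h]⟩
      oreNum := fun r _ => r
      oreDenom := fun _ s => s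
      ore_eq := fun r s => hcomm s r }
  let f : OqM n q →ₐ[ℂ] OreLocalization S (OqM n q) :=
    { OreLocalization.numeratorRingHom with commutes' := fun _ => rfl }
  have hf : Function.Injective f := by
    refine OreLocalization.numeratorHom_inj ?_
    rintro _ ⟨k, rfl⟩ a ha
    exact (mul_eq_zero.1 ha).resolve_left (pow_ne_zero k (detM_ne_zero n q))
  obtain ⟨g, hg, -⟩ := existsUnique_lift_GL n q f
    (OreLocalization.numerator_isUnit (⟨detM n q, 1, pow_one _⟩ : S))
  intro a b hab
  refine hf ?_
  rw [← hg, AlgHom.comp_apply, hab, AlgHom.comp_apply]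

theorem commute_toGL_detM {n : ℕ} {q : ℂ} (hq : q ≠ 0) (x : OqGL n q) :
    Commute (toGL n q (detM n q)) x := by
  obtain ⟨x, rfl⟩ := mkGL_surjective n q x
  induction x using FreeAlgebra.induction with
  | grade0 r => rw [AlgHom.commutes]; exact (Algebra.commutes r _).symm
  | grade1 p =>
    cases p with
    | none =>
      exact (toGL_detM_mul_detInv n q).trans (detInv_mul_toGL_detM n q).symm
    | some p =>
      have h : mkGL n q (FreeAlgebra.ι ℂ (some p)) = toGL n q (mkM n q (FreeAlgebra.ι ℂ p)) := by
        rw [toGL_mkM, freeIncl, FreeAlgebra.lift_ι_apply]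
      rw [h]
      exact (commute_detM hq _).map _
  | mul a b ha hb => rw [map_mul]; exact ha.mul_right hb
  | add a b ha hb => rw [map_add]; exact ha.add_right hb

/-- The localization at the quantum determinant of a subalgebra that contains it. -/
def localizedSubalgebra {n : ℕ} {q : ℂ} (hq : q ≠ 0) (S : Subalgebra ℂ (OqM n q))
    (hS : detM n q ∈ S) : Subalgebra ℂ (OqGL n q) where
  carrier := {x | ∃ k : ℕ, ∃ s ∈ S, x * toGL n q (detM n q) ^ k = toGL n q s}
  mul_mem' := by
    rintro x y ⟨k, s, hs, hx⟩ ⟨l, r, hr, hy⟩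
    refine ⟨k + l, s * r, S.mul_mem hs hr, ?_⟩
    rw [pow_add, mul_assoc, ← mul_assoc y, ← ((commute_toGL_detM hq y).pow_left k).eq, mul_assoc,
      hy, ← mul_assoc, hx, map_mul]
  add_mem' := by
    rintro x y ⟨k, s, hs, hx⟩ ⟨l, r, hr, hy⟩
    refine ⟨k + l, s * detM n q ^ l + r * detM n q ^ k,
      S.add_mem (S.mul_mem hs (S.pow_mem hS l)) (S.mul_mem hr (S.pow_mem hS k)), ?_⟩
    rw [map_add, map_mul, map_mul, map_pow, map_pow, ← hx, ← hy, mul_assoc, mul_assoc, ← pow_add,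
      ← pow_add, add_comm l k, add_mul]
  algebraMap_mem' r := ⟨0, algebraMap ℂ _ r, S.algebraMap_mem r, by simp⟩

theorem mem_localizedSubalgebra {n : ℕ} {q : ℂ} {hq : q ≠ 0} {S : Subalgebra ℂ (OqM n q)}
    {hS : detM n q ∈ S} {x : OqGL n q} : x ∈ localizedSubalgebra hq S hS ↔
      ∃ k : ℕ, ∃ s ∈ S, x * toGL n q (detM n q) ^ k = toGL n q s := Iff.rfl

theorem toGL_mem_localizedSubalgebra {n : ℕ} {q : ℂ} (hq : q ≠ 0) {S : Subalgebra ℂ (OqM n q)}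
    (hS : detM n q ∈ S) {s : OqM n q} (hs : s ∈ S) : toGL n q s ∈ localizedSubalgebra hq S hS :=
  ⟨0, s, hs, by simp⟩

theorem detInv_mem_localizedSubalgebra {n : ℕ} {q : ℂ} (hq : q ≠ 0) {S : Subalgebra ℂ (OqM n q)}
    (hS : detM n q ∈ S) : detInv n q ∈ localizedSubalgebra hq S hS :=
  ⟨1, 1, S.one_mem, by rw [pow_one, detInv_mul_toGL_detM, map_one]⟩

theorem exists_mul_pow_eq_toGL {n : ℕ} {q : ℂ} (hq : q ≠ 0) (x : OqGL n q) :
    ∃ (k : ℕ) (a : OqM n q), x * toGL n q (detM n q) ^ k = toGL n q a := by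
  suffices x ∈ localizedSubalgebra hq ⊤ Algebra.mem_top by
    obtain ⟨k, s, -, h⟩ := this
    exact ⟨k, s, h⟩
  obtain ⟨x, rfl⟩ := mkGL_surjective n q x
  induction x using FreeAlgebra.induction with
  | grade0 r => rw [AlgHom.commutes]; exact Subalgebra.algebraMap_mem _ r
  | grade1 p =>
    cases p with
    | none => exact detInv_mem_localizedSubalgebra hq _
    | some p =>
      have h : mkGL n q (FreeAlgebra.ι ℂ (some p)) = toGL n q (mkM n q (FreeAlgebra.ι ℂ p)) := by
        rw [toGL_mkM, freeIncl, FreeAlgebra.lift_ι_apply]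
      rw [h]
      exact toGL_mem_localizedSubalgebra hq _ Algebra.mem_top
  | mul a b ha hb => rw [map_mul]; exact Subalgebra.mul_mem _ ha hb
  | add a b ha hb => rw [map_add]; exact Subalgebra.add_mem _ ha hb

theorem detM_mem_sigmaAlg {n : ℕ} (hn : 1 ≤ n) (q : ℂ) : detM n q ∈ sigmaAlg n q := by
  rw [← sigmaM_self]
  exact sigmaM_mem_sigmaAlg q hn le_rfl

/-- The subalgebra of the localization generated by the `σ_i` and the inverse of `det_q`. -/
def sigmaAlgGL (n : ℕ) (q : ℂ) : Subalgebra ℂ (OqGL n q) :=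
  Algebra.adjoin ℂ ({y | ∃ i, 1 ≤ i ∧ i ≤ n ∧ y = toGL n q (sigmaM n q i)} ∪ {detInv n q})

theorem toGL_sigmaM_mem {n : ℕ} (q : ℂ) {i : ℕ} (h1 : 1 ≤ i) (hn : i ≤ n) :
    toGL n q (sigmaM n q i) ∈ sigmaAlgGL n q :=
  Algebra.subset_adjoin (Set.mem_union_left _ ⟨i, h1, hn, rfl⟩)

theorem detInv_mem (n : ℕ) (q : ℂ) : detInv n q ∈ sigmaAlgGL n q :=
  Algebra.subset_adjoin (Set.mem_union_right _ rfl)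

/-- A fraction commutes with σ₁ exactly when its numerator does, as det_q is central and `toGL` is
injective. For the converse only the criterion is checked: a·det_q^k lies in the algebra of the σ_i,
so the restriction of `a` becomes symmetric after multiplication by a symmetric nonzero factor. -/
theorem centralizer_GL_iff {n : ℕ} (hn : 1 ≤ n) {q : ℂ} (hq0 : q ≠ 0)
    (hq : ∀ m : ℕ, 0 < m → q ^ m ≠ 1) :
    Subalgebra.centralizer ℂ {sigmaM n q 1} = sigmaAlg n q ↔
      Subalgebra.centralizer ℂ {toGL n q (sigmaM n q 1)} = sigmaAlgGL n q := by
  have hinj := toGL_injective n hq0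
  have hmul : ∀ x : OqGL n q, ∀ k : ℕ,
      x * toGL n q (detM n q) ^ k * detInv n q ^ k = x := by
    intro x k
    have hc : Commute (toGL n q (detM n q)) (detInv n q) := commute_toGL_detM hq0 _
    rw [mul_assoc, ← hc.mul_pow, toGL_detM_mul_detInv, one_pow, mul_one]
  constructor
  · intro h
    refine le_antisymm (fun x hx => ?_) (Algebra.adjoin_le ?_)
    · obtain ⟨k, a, hxa⟩ := exists_mul_pow_eq_toGL hq0 x
      have ha : a ∈ sigmaAlg n q := by
        rw [← h]
        rintro _ rfl
        refine hinj ?_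
        rw [map_mul, map_mul, ← hxa, ← mul_assoc, hx _ rfl, mul_assoc, mul_assoc,
          ((commute_toGL_detM hq0 (toGL n q (sigmaM n q 1))).pow_left k).eq]
      rw [← hmul x k, hxa]
      refine Subalgebra.mul_mem _ ?_ (Subalgebra.pow_mem _ (detInv_mem n q) k)
      have hle : (sigmaAlg n q).map (toGL n q) ≤ sigmaAlgGL n q := by
        rw [sigmaAlg, AlgHom.map_adjoin]
        refine Algebra.adjoin_le ?_
        rintro _ ⟨_, ⟨i, h1, hi, rfl⟩, rfl⟩
        exact toGL_sigmaM_mem q h1 hi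
      exact hle ⟨a, ha, rfl⟩
    · rintro _ (⟨i, h1, hi, rfl⟩ | rfl) _ rfl
      · have : sigmaM n q i ∈ Subalgebra.centralizer ℂ {sigmaM n q 1} := by
          rw [h]
          exact sigmaM_mem_sigmaAlg q h1 hi
        rw [← map_mul, this _ rfl, map_mul]
      · have hc := commute_toGL_detM hq0 (toGL n q (sigmaM n q 1))
        calc toGL n q (sigmaM n q 1) * detInv n q
            = detInv n q * (toGL n q (detM n q) * toGL n q (sigmaM n q 1)) * detInv n q := by
              rw [← mul_assoc, detInv_mul_toGL_detM, one_mul]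
          _ = detInv n q * toGL n q (sigmaM n q 1) := by
              rw [hc.eq, mul_assoc, mul_assoc, toGL_detM_mul_detInv, mul_one]
  · intro h
    rw [centralizer_eq_sigmaAlg_iff hq0 hq]
    refine ⟨fun i h1 hi => ?_, fun a ha => ?_⟩
    · have hi' : toGL n q (sigmaM n q i) ∈
          Subalgebra.centralizer ℂ {toGL n q (sigmaM n q 1)} := by
        rw [h]
        exact toGL_sigmaM_mem q h1 hi
      refine hinj ?_
      rw [map_mul, map_mul, hi' _ rfl]
    · have ha' : toGL n q a ∈ Subalgebra.centralizer ℂ {toGL n q (sigmaM n q 1)} := by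
        rintro _ rfl
        exact (ha.map (toGL n q)).eq.symm
      rw [h] at ha'
      have hle : sigmaAlgGL n q ≤
          localizedSubalgebra hq0 (sigmaAlg n q) (detM_mem_sigmaAlg hn q) := by
        refine Algebra.adjoin_le ?_
        rintro _ (⟨i, h1, hi, rfl⟩ | rfl)
        · exact toGL_mem_localizedSubalgebra hq0 _ (sigmaM_mem_sigmaAlg q h1 hi)
        · exact detInv_mem_localizedSubalgebra hq0 _
      obtain ⟨k, s, hs, hk⟩ := mem_localizedSubalgebra.1 (hle ha')
      rw [← map_pow, ← map_mul] at hk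
      have hk' : a * detM n q ^ k = s := hinj hk
      have h1 := isSymmetric_diagHom hs
      have h2 := isSymmetric_diagHom ((sigmaAlg n q).pow_mem (detM_mem_sigmaAlg hn q) k)
      intro w
      have h3 := h1 w
      rw [← hk', map_mul, map_mul, h2 w] at h3
      refine mul_right_cancel₀ ?_ h3
      rw [map_pow]
      exact pow_ne_zero k (diagHom_detM_ne_zero n q)

end GeneralLinear

/-! ### The grading by degree -/

section Grading

/-- An element `(c - 1) * b`, with `c` homogeneous of degree `n`, whose degrees lie in an interval
of length `n` vanishes. -/
theorem eq_zero_of_degrees_in_window {R : Type*} [Ring R] [NoZeroDivisors R] (γ : R →+* R[X])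
    {n N : ℕ} (hn : 1 ≤ n) {c b : R} (hc : γ c = monomial n c) (hc0 : c ≠ 0)
    (h : ∀ k, (γ ((c - 1) * b)).coeff k ≠ 0 → N ≤ k ∧ k < N + n) : γ ((c - 1) * b) = 0 := by
  have hexp : γ ((c - 1) * b) = monomial n c * γ b - γ b := by
    rw [map_mul, map_sub, map_one, hc, sub_mul, one_mul]
  set g := γ b
  by_cases hg : g = 0
  · rw [hexp, hg, mul_zero, sub_zero]
  -- The top degree of (c - 1) b exceeds that of b by n, while its lowest degree is that of b, so
  -- they cannot share an interval of length n.
  have htop := h (g.natDegree + n) <| by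
    rw [hexp, coeff_sub, coeff_monomial_mul, coeff_natDegree,
      coeff_eq_zero_of_natDegree_lt (by omega : g.natDegree < g.natDegree + n), sub_zero]
    exact mul_ne_zero hc0 (leadingCoeff_ne_zero.2 hg)
  have hbot := h g.natTrailingDegree <| by
    have h1 : (monomial n c * g).coeff g.natTrailingDegree = 0 := by
      by_cases hle : n ≤ g.natTrailingDegree
      · obtain ⟨d, hd⟩ := Nat.exists_eq_add_of_le' hle
        rw [hd, coeff_monomial_mul, coeff_eq_zero_of_lt_natTrailingDegree (by omega), mul_zero]
      · rw [← C_mul_X_pow_eq_monomial, mul_assoc, coeff_C_mul, coeff_X_pow_mul', if_neg hle,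
          mul_zero]
    rw [hexp, coeff_sub, h1, zero_sub, neg_ne_zero]
    exact mt trailingCoeff_eq_zero.1 hg
  have := natTrailingDegree_le_natDegree g
  omega

variable {n : ℕ} {q : ℂ}

/-- The homomorphism that records the degree of homogeneous elements. -/
def degHom (n : ℕ) (q : ℂ) : OqM n q →ₐ[ℂ] (OqM n q)[X] :=
  OqM.lift ((genX n q).map (monomial 1)) <| by
    have h := isQMatrix_genX n q
    refine ⟨fun i j k l hik hjl => ?_, fun i j l hjl => ?_, fun i j k hik => ?_,
      fun i j k l hik hlj => ?_⟩
    · simp only [Matrix.map_apply, monomial_mul_monomial, h.diag hik hjl, smul_monomial, map_add]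
    · simp only [Matrix.map_apply, monomial_mul_monomial, h.row hjl, smul_monomial]
    · simp only [Matrix.map_apply, monomial_mul_monomial, h.col hik, smul_monomial]
    · simp only [Matrix.map_apply, monomial_mul_monomial, h.anti hik hlj]

theorem degHom_genX (i j : Fin n) : degHom n q (genX n q i j) = monomial 1 (genX n q i j) :=
  OqM.lift_genX _ _ i j

/-- Homogeneous elements of degree `d`. -/
def IsHomog (d : ℕ) (a : OqM n q) : Prop := degHom n q a = monomial d a

theorem IsHomog.of_eq {d e : ℕ} {a : OqM n q} (ha : IsHomog d a) (h : d = e) : IsHomog e a :=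
  h ▸ ha

theorem IsHomog.mul {d e : ℕ} {a b : OqM n q} (ha : IsHomog d a) (hb : IsHomog e b) :
    IsHomog (d + e) (a * b) := by
  rw [IsHomog, map_mul, ha, hb, monomial_mul_monomial]

theorem IsHomog.pow {d : ℕ} {a : OqM n q} (ha : IsHomog d a) (k : ℕ) :
    IsHomog (d * k) (a ^ k) := by
  rw [IsHomog, map_pow, ha, monomial_pow]

theorem IsHomog.sub {d : ℕ} {a b : OqM n q} (ha : IsHomog d a) (hb : IsHomog d b) :
    IsHomog d (a - b) := by
  rw [IsHomog, map_sub, ha, hb, map_sub]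

theorem IsHomog.smul {d : ℕ} {a : OqM n q} (ha : IsHomog d a) (c : ℂ) : IsHomog d (c • a) := by
  rw [IsHomog, map_smul, ha, smul_monomial]

theorem IsHomog.sum {d : ℕ} {ι : Type*} {s : Finset ι} {a : ι → OqM n q}
    (ha : ∀ i ∈ s, IsHomog d (a i)) : IsHomog d (∑ i ∈ s, a i) := by
  rw [IsHomog, map_sum, map_sum]
  exact Finset.sum_congr rfl ha

theorem isHomog_list_prod {t : ℕ} {a : Fin t → OqM n q} (ha : ∀ i, IsHomog 1 (a i)) :
    IsHomog t (List.ofFn a).prod := by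
  induction t with
  | zero => simp [IsHomog]
  | succ t ih =>
    rw [List.ofFn_succ, List.prod_cons]
    exact ((ha 0).mul (ih fun i => ha i.succ)).of_eq (add_comm 1 t)

theorem isHomog_sigmaM (t : ℕ) : IsHomog t (sigmaM n q t) := by
  rw [sigmaM, qSigma]
  refine IsHomog.sum fun I _ => ?_
  rw [qMinor, qDet]
  exact IsHomog.sum fun s _ => (isHomog_list_prod fun a => degHom_genX _ _).smul _

theorem isHomog_detM : IsHomog n (detM n q) := by
  rw [← sigmaM_self]
  exact isHomog_sigmaM n

theorem isHomog_coeff_degHom (a : OqM n q) : ∀ d, IsHomog d ((degHom n q a).coeff d) := by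
  induction a using OqM.induction with
  | one =>
    intro d
    rw [map_one, coeff_one]
    split_ifs with h
    · simp [IsHomog, h]
    · simp [IsHomog]
  | smul c a ih => intro d; rw [map_smul, coeff_smul]; exact (ih d).smul c
  | add a b iha ihb =>
    intro d
    rw [map_add, coeff_add, IsHomog, map_add, iha d, ihb d, map_add]
  | mul i j a ih =>
    intro d
    rw [map_mul, degHom_genX]
    cases d with
    | zero => simp [IsHomog, mul_coeff_zero, coeff_monomial]
    | succ d =>
      rw [coeff_monomial_mul, add_comm]
      exact IsHomog.mul (degHom_genX i j) (ih d)

/-- `degHom a` is the generating polynomial of the homogeneous components, so setting X = 1 adds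
them up; in particular `degHom` is injective. -/
theorem eval_one_degHom (a : OqM n q) : (degHom n q a).eval 1 = a := by
  induction a using OqM.induction with
  | one => simp
  | smul c a ih => rw [map_smul, eval_smul, ih]
  | add a b iha ihb => rw [map_add, eval_add, iha, ihb]
  | mul i j a ih =>
    rw [map_mul, degHom_genX, ← C_mul_X_pow_eq_monomial, pow_one, mul_assoc, X_mul, eval_C_mul,
      eval_mul_X, mul_one, ih]

theorem sum_coeff_degHom (a : OqM n q) :
    ∑ d ∈ (degHom n q a).support, (degHom n q a).coeff d = a := by
  conv_rhs => rw [← eval_one_degHom a, eval_eq_sum, Polynomial.sum_def]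
  simp

theorem eq_zero_of_degHom_eq_zero {a : OqM n q} (h : degHom n q a = 0) : a = 0 := by
  rw [← eval_one_degHom a, h, eval_zero]

/-- As σ₁ is homogeneous of degree 1, the degree d + 1 part of the commutation involves only the
component of degree d. -/
theorem commute_coeff_degHom {a : OqM n q} (ha : Commute a (sigmaM n q 1)) (d : ℕ) :
    Commute ((degHom n q a).coeff d) (sigmaM n q 1) := by
  have h := congrArg (fun g => g.coeff (d + 1)) (ha.map (degHom n q)).eq
  rw [isHomog_sigmaM 1] at h
  simp only [coeff_mul_monomial, coeff_monomial_mul] at h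
  exact h

/-- The homomorphism that records the degree of homogeneous polynomials. -/
def polyDegHom (n : ℕ) : MvPolynomial (Fin n) ℂ →ₐ[ℂ] (MvPolynomial (Fin n) ℂ)[X] :=
  MvPolynomial.aeval fun i => monomial 1 (MvPolynomial.X i)

theorem polyDegHom_diagHom (a : OqM n q) : polyDegHom n (diagHom n q a) =
    (degHom n q a).map (diagHom n q : OqM n q →+* MvPolynomial (Fin n) ℂ) := by
  have : (polyDegHom n).comp (diagHom n q) =
      (Polynomial.mapAlgHom (diagHom n q)).comp (degHom n q) := by
    refine (isPresentedOn_genX n q).hom_ext fun i j => ?_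
    rw [AlgHom.comp_apply, AlgHom.comp_apply, diagHom_genX, degHom_genX]
    by_cases h : i = j
    · subst h
      simp [polyDegHom, diagHom_genX]
    · simp [diagHom_genX, h]
  exact DFunLike.congr_fun this a

theorem polyDegHom_rename (w : Equiv.Perm (Fin n)) (f : MvPolynomial (Fin n) ℂ) :
    polyDegHom n (MvPolynomial.rename w f) =
      (polyDegHom n f).map (MvPolynomial.rename w : MvPolynomial (Fin n) ℂ →ₐ[ℂ] _).toRingHom := by
  have : (polyDegHom n).comp (MvPolynomial.rename w) =
      (Polynomial.mapAlgHom (MvPolynomial.rename w)).comp (polyDegHom n) := by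
    ext1 i
    simp [polyDegHom]
  exact DFunLike.congr_fun this f

theorem eq_zero_of_polyDegHom_eq_zero {f : MvPolynomial (Fin n) ℂ} (h : polyDegHom n f = 0) :
    f = 0 := by
  have h1 : ((Polynomial.aeval (1 : MvPolynomial (Fin n) ℂ)).restrictScalars ℂ).comp
      (polyDegHom n) = AlgHom.id ℂ _ := by
    ext1 i
    simp [polyDegHom]
  have := DFunLike.congr_fun h1 f
  rw [AlgHom.comp_apply, h, map_zero] at this
  exact this.symm

end Grading

/-! ### Comparison with O_q(SL_n) -/

section SpecialLinear

variable {n : ℕ} {q : ℂ}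

theorem toSL_surjective : Function.Surjective (toSL n q) := RingCon.mkₐ_surjective _

/-- Centrality of det_q - 1 makes its multiples a two-sided ideal already. -/
theorem toSL_eq_iff (hq : q ≠ 0) {a b : OqM n q} :
    toSL n q a = toSL n q b ↔ ∃ c, a - b = (detM n q - 1) * c := by
  have h1 : toSL n q a = toSL n q b ↔ a - b ∈ TwoSidedIdeal.span {detM n q - 1} := by
    rw [← TwoSidedIdeal.rel_iff]
    exact RingCon.eq _
  rw [h1]
  constructor
  · intro h
    have hc : ∀ x, Commute (detM n q - 1) x := fun x =>
      (commute_detM hq x).sub_left (Commute.one_left x)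
    generalize a - b = x at h
    induction h using TwoSidedIdeal.span_induction with
    | mem x hx => exact ⟨1, by rw [mul_one]; exact hx⟩
    | zero => exact ⟨0, (mul_zero _).symm⟩
    | add x y _ _ hx hy =>
      obtain ⟨c, rfl⟩ := hx
      obtain ⟨d, rfl⟩ := hy
      exact ⟨c + d, (mul_add _ _ _).symm⟩
    | neg x _ hx =>
      obtain ⟨c, rfl⟩ := hx
      exact ⟨-c, (mul_neg _ _).symm⟩
    | left_absorb r x _ hx =>
      obtain ⟨c, rfl⟩ := hx
      exact ⟨r * c, by rw [← mul_assoc, ← (hc r).eq, mul_assoc]⟩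
    | right_absorb r x _ hx =>
      obtain ⟨c, rfl⟩ := hx
      exact ⟨c * r, by rw [mul_assoc]⟩
  · rintro ⟨c, hc⟩
    rw [hc]
    exact TwoSidedIdeal.mul_mem_right _ _ _ (TwoSidedIdeal.subset_span rfl)

theorem toSL_detM (hq : q ≠ 0) : toSL n q (detM n q) = 1 := by
  rw [← map_one (toSL n q), toSL_eq_iff hq]
  exact ⟨1, (mul_one _).symm⟩

theorem eq_of_toSL_eq (hn : 1 ≤ n) (hq : q ≠ 0) {N : ℕ} {a b : OqM n q} (hab : toSL n q a = toSL n q b)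
    (h : ∀ k, (degHom n q (a - b)).coeff k ≠ 0 → N ≤ k ∧ k < N + n) : a = b := by
  have hdom := OqM.noZeroDivisors n hq
  obtain ⟨c, hc⟩ := (toSL_eq_iff hq).1 hab
  rw [hc] at h
  have := eq_zero_of_degrees_in_window (degHom n q).toRingHom hn isHomog_detM
    (detM_ne_zero n q) h
  exact sub_eq_zero.1 (eq_zero_of_degHom_eq_zero (by rw [hc]; exact this))

/-- Every element of `OqSL n q` has a lift whose degrees lie in a prescribed high interval of
length `n`. -/
theorem exists_lift_in_window (hn : 1 ≤ n) (hq : q ≠ 0) (a : OqM n q) :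
    ∃ N a', toSL n q a' = toSL n q a ∧
      ∀ k, (degHom n q a').coeff k ≠ 0 → N ≤ k ∧ k < N + n := by
  -- Asking for every sufficiently late interval makes the claim additive: finitely many components
  -- can then be moved into a common one.
  suffices ∃ N₀, ∀ N ≥ N₀, ∃ a', toSL n q a' = toSL n q a ∧
      ∀ k, (degHom n q a').coeff k ≠ 0 → N * n ≤ k ∧ k < N * n + n by
    obtain ⟨N₀, h⟩ := this
    exact ⟨_, h N₀ le_rfl⟩
  rw [← sum_coeff_degHom a]
  refine Finset.sum_induction _ (fun a => ∃ N₀, ∀ N ≥ N₀, ∃ a', toSL n q a' = toSL n q a ∧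
      ∀ k, (degHom n q a').coeff k ≠ 0 → N * n ≤ k ∧ k < N * n + n) ?_ ?_ ?_
  · rintro a b ⟨N₀, h₀⟩ ⟨N₁, h₁⟩
    refine ⟨max N₀ N₁, fun N hN => ?_⟩
    obtain ⟨a', ha, ha'⟩ := h₀ N (le_trans (le_max_left _ _) hN)
    obtain ⟨b', hb, hb'⟩ := h₁ N (le_trans (le_max_right _ _) hN)
    refine ⟨a' + b', by rw [map_add, map_add, ha, hb], fun k hk => ?_⟩
    rw [map_add, coeff_add] at hk
    by_cases h : (degHom n q a').coeff k = 0
    · exact hb' k (by rwa [h, zero_add] at hk)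
    · exact ha' k h
  · exact ⟨0, fun N _ => ⟨0, rfl, by simp⟩⟩
  · intro m _
    -- Multiplication by det_q, which maps to 1, raises the degree by n; this exponent takes degree
    -- m to N n + m % n.
    refine ⟨m / n, fun N hN => ⟨(degHom n q a).coeff m * detM n q ^ (N - m / n), ?_, ?_⟩⟩
    · rw [map_mul, map_pow, toSL_detM hq, one_pow, mul_one]
    · intro k hk
      have hh := (isHomog_coeff_degHom a m).mul (isHomog_detM.pow (N - m / n))
      have hm := Nat.div_add_mod m n
      have hlt := Nat.mod_lt m hn
      obtain ⟨l, rfl⟩ := Nat.exists_eq_add_of_le hN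
      rw [Nat.add_sub_cancel_left] at hh hk
      rw [hh, coeff_monomial] at hk
      have hk' : m + n * l = k := by
        by_contra h
        exact hk (if_neg h)
      have : (m / n + l) * n = n * (m / n) + n * l := by ring
      omega

/-- The subalgebra of `OqSL n q` generated by the images of the `σ_i`. -/
def sigmaAlgSL (n : ℕ) (q : ℂ) : Subalgebra ℂ (OqSL n q) :=
  Algebra.adjoin ℂ {y | ∃ i, 1 ≤ i ∧ i < n ∧ y = toSL n q (sigmaM n q i)}

theorem map_sigmaAlg_toSL (hq : q ≠ 0) : (sigmaAlg n q).map (toSL n q) = sigmaAlgSL n q := by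
  rw [sigmaAlg, AlgHom.map_adjoin]
  refine le_antisymm (Algebra.adjoin_le ?_) (Algebra.adjoin_le ?_)
  · rintro _ ⟨_, ⟨i, h1, hi, rfl⟩, rfl⟩
    rcases hi.lt_or_eq with hi | rfl
    · exact Algebra.subset_adjoin ⟨i, h1, hi, rfl⟩
    · rw [sigmaM_self]
      exact (toSL_detM hq).symm ▸ Subalgebra.one_mem _
  · rintro _ ⟨i, h1, hi, rfl⟩
    exact Algebra.subset_adjoin ⟨_, ⟨i, h1, hi.le, rfl⟩, rfl⟩

/-- Write a = s + (det_q - 1) c with s in the algebra of the σ_i, restrict to the torus and apply w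
- 1 for a permutation w. The terms s and det_q are invariant, so (w - 1) a is a multiple of det_q -
1; being homogeneous, it vanishes. -/
theorem isSymmetric_of_toSL_mem (hn : 1 ≤ n) (hq : q ≠ 0) {d : ℕ} {a : OqM n q} (ha : IsHomog d a)
    (h : toSL n q a ∈ sigmaAlgSL n q) : (diagHom n q a).IsSymmetric := by
  rw [← map_sigmaAlg_toSL hq] at h
  obtain ⟨s, hs, hsa⟩ := h
  obtain ⟨c, hc⟩ := (toSL_eq_iff hq).1 hsa.symm
  intro w
  have hs' := isSymmetric_diagHom hs w
  have hdet := isSymmetric_diagHom (detM_mem_sigmaAlg hn q) w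
  have h1 := congrArg (diagHom n q) hc
  rw [map_sub, map_mul, map_sub, map_one] at h1
  have h2 := congrArg (MvPolynomial.rename w) h1
  rw [map_sub, map_mul, map_sub, map_one, hs', hdet] at h2
  have h3 : MvPolynomial.rename w (diagHom n q a) - diagHom n q a =
      (diagHom n q (detM n q) - 1) *
        (MvPolynomial.rename w (diagHom n q c) - diagHom n q c) := by
    rw [mul_sub, ← h1, ← h2]
    ring
  have hD : polyDegHom n (diagHom n q a) = monomial d (diagHom n q a) := by
    rw [polyDegHom_diagHom, ha, map_monomial]
    rfl
  have hDdet : polyDegHom n (diagHom n q (detM n q)) = monomial n (diagHom n q (detM n q)) := by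
    rw [polyDegHom_diagHom, isHomog_detM, map_monomial]
    rfl
  have h4 : polyDegHom n (MvPolynomial.rename w (diagHom n q a) - diagHom n q a) =
      monomial d (MvPolynomial.rename w (diagHom n q a) - diagHom n q a) := by
    rw [map_sub, polyDegHom_rename, hD, map_monomial, map_sub]
    rfl
  have h5 := eq_zero_of_degrees_in_window (N := d) (polyDegHom n).toRingHom hn hDdet
    (diagHom_detM_ne_zero n q) (b := MvPolynomial.rename w (diagHom n q c) - diagHom n q c) <| by
      rw [← h3]
      intro k hk
      change (polyDegHom n _).coeff k ≠ 0 at hk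
      rw [h4, coeff_monomial] at hk
      have : d = k := by
        by_contra h
        exact hk (if_neg h)
      omega
  rw [← h3] at h5
  exact sub_eq_zero.1 (eq_zero_of_polyDegHom_eq_zero h5)

/-- A class that commutes with the image of σ₁ is lifted to an interval of length n, where the lift
itself must commute with σ₁. Conversely the criterion is checked on homogeneous elements: the
commutators of σ_i with σ₁, and the homogeneous components of an element of the centralizer. -/
theorem centralizer_SL_iff (hn : 1 ≤ n) (hq0 : q ≠ 0) (hq : ∀ m : ℕ, 0 < m → q ^ m ≠ 1) :
    Subalgebra.centralizer ℂ {sigmaM n q 1} = sigmaAlg n q ↔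
      Subalgebra.centralizer ℂ {toSL n q (sigmaM n q 1)} = sigmaAlgSL n q := by
  constructor
  · intro h
    rw [← map_sigmaAlg_toSL hq0]
    refine le_antisymm (fun x hx => ?_) ?_
    · obtain ⟨a, rfl⟩ := toSL_surjective x
      obtain ⟨N, a', ha, ha'⟩ := exists_lift_in_window hn hq0 a
      rw [← ha] at hx ⊢
      refine ⟨a', ?_, rfl⟩
      change a' ∈ sigmaAlg n q
      rw [← h]
      rintro _ rfl
      -- Multiplication by σ₁ shifts the interval by one without lengthening it.
      refine eq_of_toSL_eq (N := N + 1) hn hq0 ?_ fun k hk => ?_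
      · rw [map_mul, map_mul]
        exact hx _ rfl
      · rw [map_sub, map_mul, map_mul, isHomog_sigmaM 1] at hk
        cases k with
        | zero => simp [mul_coeff_zero, coeff_monomial] at hk
        | succ k =>
          rw [coeff_sub, coeff_monomial_mul, coeff_mul_monomial] at hk
          have := ha' k fun h0 => hk (by rw [h0, mul_zero, zero_mul, sub_zero])
          omega
    · rw [← h]
      rintro _ ⟨a, ha, rfl⟩ _ rfl
      have := congrArg (toSL n q) (ha _ rfl)
      rw [map_mul, map_mul] at this
      exact this
  · intro h
    rw [centralizer_eq_sigmaAlg_iff hq0 hq]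
    refine ⟨fun i h1 hi => ?_, fun a ha => ?_⟩
    · rcases hi.lt_or_eq with hi | rfl
      · have hi' : toSL n q (sigmaM n q i) ∈
            Subalgebra.centralizer ℂ {toSL n q (sigmaM n q 1)} := by
          rw [h]
          exact Algebra.subset_adjoin ⟨i, h1, hi, rfl⟩
        refine eq_of_toSL_eq (N := i + 1) hn hq0 ?_ fun k hk => ?_
        · rw [map_mul, map_mul]
          exact (hi' _ rfl).symm
        · have hh := ((isHomog_sigmaM i).mul (isHomog_sigmaM 1)).sub
            (((isHomog_sigmaM (n := n) (q := q) 1).mul (isHomog_sigmaM i)).of_eq (add_comm 1 i))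
          rw [hh, coeff_monomial] at hk
          have : i + 1 = k := by
            by_contra h
            exact hk (if_neg h)
          omega
      · rw [sigmaM_self]
        exact commute_detM hq0 _
    · have hsum : diagHom n q a = ∑ d ∈ (degHom n q a).support,
          diagHom n q ((degHom n q a).coeff d) := by
        rw [← map_sum, sum_coeff_degHom]
      rw [hsum]
      refine (MvPolynomial.symmetricSubalgebra (Fin n) ℂ).sum_mem fun d _ => ?_
      refine isSymmetric_of_toSL_mem hn hq0 (isHomog_coeff_degHom a d) ?_
      rw [← h]
      rintro _ rfl
      have := congrArg (toSL n q) (commute_coeff_degHom ha d).eq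
      rw [map_mul, map_mul] at this
      exact this.symm

end SpecialLinear

end QuantumMatrices

end

theorem proposition3 (n : ℕ) (hn : 1 ≤ n) (q : ℂ) (hq0 : q ≠ 0)
    (hq : ∀ m : ℕ, 0 < m → q ^ m ≠ 1) :
    List.TFAE [
      Subalgebra.centralizer ℂ {QuantumMatrices.sigmaM n q 1} =
        Algebra.adjoin ℂ {y | ∃ i, 1 ≤ i ∧ i ≤ n ∧ y = QuantumMatrices.sigmaM n q i},
      Subalgebra.centralizer ℂ {QuantumMatrices.toGL n q (QuantumMatrices.sigmaM n q 1)} =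
        Algebra.adjoin ℂ
          ({y | ∃ i, 1 ≤ i ∧ i ≤ n ∧
              y = QuantumMatrices.toGL n q (QuantumMatrices.sigmaM n q i)} ∪
            {QuantumMatrices.detInv n q}),
      Subalgebra.centralizer ℂ {QuantumMatrices.toSL n q (QuantumMatrices.sigmaM n q 1)} =
        Algebra.adjoin ℂ {y | ∃ i, 1 ≤ i ∧ i < n ∧
          y = QuantumMatrices.toSL n q (QuantumMatrices.sigmaM n q i)}] := by
  tfae_have 1 ↔ 2 := QuantumMatrices.centralizer_GL_iff hn hq0 hq
  tfae_have 1 ↔ 3 := QuantumMatrices.centralizer_SL_iff hn hq0 hq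
  tfae_finish
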